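/- Throughout, graphs are simple; for a vertex $v$ of a graph $G$ and $r\in\mathbb N$, $B_G(v,r)$ denotes the subgraph of $G$ induced on the vertices at graph distance at most $r$ from $v$, and $\log^*(n)$ is the minimum number of times $\log_2$ has to be applied to $n$ to reach a value that is at most $2$. Let $\Delta\ge 3$ be an integer and let $f:\mathbb N\to\mathbb N$ be subexponential, i.e. $f\in o((1+\varepsilon)^n)$ for every $\varepsilon>0$. Let $\mathbf F$ be a class of finite graphs such that every $G\in\mathbf F$ has growth bounded by $f$ (that is, $|B_G(v,r)|<f(r)$ for all $v\in V(G)$ and $r\in\mathbb N$), has all degrees at most $\Delta$, and does not contain the complete graph on $\Delta+1$ vertices. Then vertex coloring with $\Delta$ colors (Brooks coloring) on $\mathbf F$ has a deterministic distributed algorithm of LOCAL complexity $O(\log^*(n))$. Explicitly: for every fixed integer $c\ge 1$ there are a sequence $(t_n)_{n}$ of natural numbers with $t_n\in O(\log^*(n))$ and functions $(\mathcal A_n)_n$ such that for every $G\in\mathbf F$ with $n=|V(G)|$ and every injective assignment of identifiers $id:V(G)\to\{0,\dots,n^c-1\}$, the map $$v\mapsto \mathcal A_n\bigl(B_G(v,t_n)\bigr),$$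 where $\mathcal A_n$ is given the rooted graph $B_G(v,t_n)$ (rooted at $v$) together with the restriction of $id$ to its vertices, and depends on it only up to isomorphism preserving the root and the identifiers, is a proper vertex coloring of $G$ with $\Delta$ colors. -/

import Mathlib

open Filter Asymptotics

universe u

noncomputable section

/-- A class of finite (simple) graphs. -/
abbrev FinGraphClass : Type (u + 1) := ∀ V : Type u, [Finite V] → SimpleGraph V → Prop

/-! ### Growth -/

/-- The vertices at graph distance at most `r` from `v`. -/
def closedNbhd {V : Type u} (G : SimpleGraph V) (v : V) (r : ℕ) : Set V :=
  {w | G.edist v w ≤ (r : ℕ∞)}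

/-- `f` bounds the growth of `G`: every ball of radius `r` has fewer than `f r` vertices. -/
def BoundsGrowth (f : ℕ → ℕ) {V : Type u} (G : SimpleGraph V) : Prop :=
  ∀ (v : V) (r : ℕ), (closedNbhd G v r).encard < (f r : ℕ∞)

/-- `f` is subexponential: `f ∈ o((1 + ε)^n)` for every `ε > 0`. -/
def Subexponential (f : ℕ → ℕ) : Prop :=
  ∀ ε : ℝ, 0 < ε → (fun n : ℕ => (f n : ℝ)) =o[atTop] (fun n : ℕ => (1 + ε) ^ n)

/-! ### The iterated logarithm -/

/-- `log* n`: the least number of times the (binary) logarithm has to be applied to `n` to reach a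
value that is at most `2`. -/
def logStar (n : ℕ) : ℕ := sInf {k : ℕ | (Real.logb 2)^[k] (n : ℝ) ≤ 2}

/-- The set in the definition of `logStar` is nonempty, so the infimum is a minimum. -/
theorem exists_iterate_logb_le_two (n : ℕ) : ∃ k : ℕ, (Real.logb 2)^[k] (n : ℝ) ≤ 2 := by
  suffices h : ∀ m : ℕ, ∀ x : ℝ, x ≤ m → ∃ k : ℕ, (Real.logb 2)^[k] x ≤ 2 from h n n le_rfl
  intro m
  induction m with
  | zero => exact fun x hx => ⟨0, by simp at hx ⊢; linarith⟩
  | succ m ih =>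
    intro x hx
    by_cases h2 : x ≤ 2
    · exact ⟨0, by simpa using h2⟩
    push Not at h2
    have hlog2 : (1 : ℝ) / 2 < Real.log 2 := by linarith [Real.log_two_gt_d9]
    have hx2 : Real.log (x / 2) ≤ x / 2 - 1 := Real.log_le_sub_one_of_pos (by linarith)
    rw [Real.log_div (by linarith) (by norm_num)] at hx2
    have hle : Real.logb 2 x ≤ x - 1 := by
      rw [Real.logb, div_le_iff₀ (by linarith)]
      nlinarith
    obtain ⟨k, hk⟩ := ih (Real.logb 2 x) (by push_cast at hx; linarith)
    exact ⟨k + 1, by simpa using hk⟩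

/-! ### Deterministic distributed algorithms in the LOCAL model -/

/-- A rooted graph whose vertices carry distinct identifiers from `L`. As identifiers are unique,
such a graph is given, up to isomorphism, by the identifier of its root, the set of the identifiers
that occur and the adjacency relation between identifiers. -/
structure LabeledBall (L : Type) where
  /-- the identifier of the root -/
  root : L
  /-- the identifiers of the vertices -/
  verts : Set L
  /-- adjacency of identifiers -/
  graph : SimpleGraph L

/-- The `t`-neighborhood of `v` in `G` together with the identifiers of its vertices: the subgraph
of `G` induced on the vertices at distance at most `t` from `v`, rooted at `v` and written in terms
of identifiers. -/
def labeledBall {V : Type u} {L : Type} (G : SimpleGraph V) (ident : V ↪ L) (v : V) (t : ℕ) :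
    LabeledBall L where
  root := ident v
  verts := ident '' closedNbhd G v t
  graph := (G.induce (closedNbhd G v t)).map (fun w => ident w.1)

/-- A deterministic distributed algorithm with outputs in `κ`: for each number of vertices `n`, a
function from neighborhoods labeled with identifiers from `{0, …, n ^ c - 1}` to outputs. -/
abbrev DetDistributedAlgorithm (c : ℕ) (κ : Type) : Type :=
  ∀ n : ℕ, LabeledBall (Fin (n ^ c)) → κ

/-- The output at the vertex `v` of the algorithm `A`, run with radius `t n` on the graph `G` with
`n` vertices and unique identifiers `ident`. -/
def DetDistributedAlgorithm.output {c : ℕ} {κ : Type} (A : DetDistributedAlgorithm c κ)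
    (t : ℕ → ℕ) {V : Type u} (G : SimpleGraph V) (ident : V ↪ Fin (Nat.card V ^ c)) (v : V) : κ :=
  A (Nat.card V) (labeledBall G ident v (t (Nat.card V)))

/-- On the class `F`, vertex coloring with `k` colors has a deterministic distributed algorithm of
LOCAL complexity `t`: for each graph in `F` and each assignment of unique identifiers, the outputs
form a proper vertex coloring with `k` colors. -/
def HasDetLocalColoring (F : FinGraphClass.{u}) (c k : ℕ) (t : ℕ → ℕ) : Prop :=
  ∃ A : DetDistributedAlgorithm c (Fin k),
    ∀ (V : Type u) [Finite V] (G : SimpleGraph V), F V G →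
      ∀ ident : V ↪ Fin (Nat.card V ^ c),
        ∀ v w : V, G.Adj v w → A.output t G ident v ≠ A.output t G ident w

end

noncomputable section

/-! ### List colorings of finite vertex sets -/

section ListColoring

variable {V κ : Type*}

open Classical in
/-- The number of neighbors of `u` in `S`. -/
def degIn (G : SimpleGraph V) (S : Finset V) (u : V) : ℕ := (S.filter (G.Adj u)).card

/-- `S` is nonempty and induces a connected subgraph of `G`. -/
def ConnIn (G : SimpleGraph V) (S : Finset V) : Prop :=
  S.Nonempty ∧ ∀ A ⊆ S, A.Nonempty → (∀ a ∈ A, ∀ b ∈ S, G.Adj a b → b ∈ A) → A = S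

/-- The subgraph of `G` induced on `S` has a proper coloring from the lists `ℓ`. -/
def ListColorable (G : SimpleGraph V) (S : Finset V) (ℓ : V → Finset κ) : Prop :=
  ∃ φ : V → κ, (∀ u ∈ S, φ u ∈ ℓ u) ∧ ∀ u ∈ S, ∀ w ∈ S, G.Adj u w → φ u ≠ φ w

/-- `S` is connected and has no proper coloring from the lists `ℓ`, although each list is at least
as large as the degree. -/
structure IsBad (G : SimpleGraph V) (S : Finset V) (ℓ : V → Finset κ) : Prop where
  conn : ConnIn G S
  le : ∀ u ∈ S, degIn G S u ≤ (ℓ u).card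
  not_colorable : ¬ ListColorable G S ℓ

/-- `D` is a union of components of `S \ {x}`, but not all of `S \ {x}`. -/
structure IsLobe (G : SimpleGraph V) (S D : Finset V) (x : V) : Prop where
  subset : D ⊆ S
  nonempty : D.Nonempty
  mem : x ∈ S
  notMem : x ∉ D
  exists_rest : ∃ y ∈ S, y ≠ x ∧ y ∉ D
  closed : ∀ a ∈ D, ∀ b ∈ S, G.Adj a b → b = x ∨ b ∈ D

variable {G : SimpleGraph V} {S T D : Finset V} {ℓ : V → Finset κ} {u w x : V}

theorem degIn_mono (h : S ⊆ T) (u : V) : degIn G S u ≤ degIn G T u := by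
  classical
  exact Finset.card_le_card (Finset.filter_subset_filter _ h)

theorem degIn_lt_of_adj (h : S ⊆ T) (hw : w ∈ T) (hwS : w ∉ S) (ha : G.Adj u w) :
    degIn G S u < degIn G T u := by
  classical
  refine Finset.card_lt_card ⟨Finset.filter_subset_filter _ h, fun hc => hwS ?_⟩
  exact (Finset.mem_filter.1 (hc (Finset.mem_filter.2 ⟨hw, ha⟩))).1

theorem degIn_congr (h : ∀ b, G.Adj u b → (b ∈ S ↔ b ∈ T)) : degIn G S u = degIn G T u := by
  classical
  unfold degIn
  congr 1
  ext b
  simp only [Finset.mem_filter]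
  constructor
  · exact fun hb => ⟨(h b hb.2).1 hb.1, hb.2⟩
  · exact fun hb => ⟨(h b hb.2).2 hb.1, hb.2⟩

theorem degIn_union [DecidableEq V] (h : Disjoint S T) (u : V) :
    degIn G (S ∪ T) u = degIn G S u + degIn G T u := by
  classical
  unfold degIn
  rw [Finset.filter_union, Finset.card_union_of_disjoint]
  exact Finset.disjoint_filter_filter h

theorem degIn_erase_add [DecidableEq V] (hu : u ∈ S) (w : V) [Decidable (G.Adj w u)] :
    degIn G S w = degIn G (S.erase u) w + if G.Adj w u then 1 else 0 := by
  classical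
  have h : S = S.erase u ∪ {u} := by
    ext b; by_cases hb : b = u <;> simp [hb, hu]
  conv_lhs => rw [h]
  rw [degIn_union (by simp)]
  congr 1
  unfold degIn
  by_cases ha : G.Adj w u <;> simp [ha, Finset.filter_singleton]

theorem degIn_lt_card (hu : u ∈ S) : degIn G S u < S.card := by
  classical
  refine Finset.card_lt_card ⟨Finset.filter_subset _ _, fun h => ?_⟩
  exact G.irrefl (Finset.mem_filter.1 (h hu)).2

theorem sum_degIn_erase [DecidableEq V] (hx : x ∈ S) :
    ∑ u ∈ S, degIn G S u = ∑ u ∈ S.erase x, degIn G (S.erase x) u + 2 * degIn G S x := by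
  classical
  rw [← Finset.add_sum_erase S _ hx, Finset.sum_congr rfl (fun w _ => degIn_erase_add hx w),
    Finset.sum_add_distrib]
  have : ∑ w ∈ S.erase x, (if G.Adj w x then 1 else 0) = degIn G S x := by
    rw [Finset.sum_boole]
    rw [degIn_congr (T := S.erase x)]
    · simp [degIn, G.adj_comm]
    · intro b hb
      simp [hb.ne']
  rw [this]
  ring

/-- Greedy coloring: the vertex of small degree is colored last. -/
theorem listColorable_of_degenerate [Nonempty κ]
    (h : ∀ A ⊆ S, A.Nonempty → ∃ a ∈ A, degIn G A a < (ℓ a).card) : ListColorable G S ℓ := by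
  classical
  induction S using Finset.strongInduction with
  | H S ih =>
    by_cases hS : S.Nonempty
    · obtain ⟨a, ha, hlt⟩ := h S subset_rfl hS
      obtain ⟨φ, h1, h2⟩ := ih (S.erase a) (Finset.erase_ssubset ha)
        fun A hA => h A (hA.trans (Finset.erase_subset _ _))
      have : ∃ c ∈ ℓ a, c ∉ (S.filter (G.Adj a)).image φ :=
        Finset.exists_mem_notMem_of_card_lt_card (Finset.card_image_le.trans_lt hlt)
      obtain ⟨c, hc, hcn⟩ := this
      simp only [Finset.mem_image, Finset.mem_filter, not_exists, not_and, and_imp] at hcn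
      refine ⟨Function.update φ a c, fun u hu => ?_, fun u hu w hw huw => ?_⟩
      · by_cases hua : u = a
        · simpa [hua] using hc
        · simpa [hua] using h1 u (by simp [hua, hu])
      · by_cases hua : u = a
        · subst hua
          simpa [huw.ne'] using fun h => hcn w hw huw h.symm
        · by_cases hwa : w = a
          · subst hwa
            simpa [hua] using hcn u hu huw.symm
          · simpa [hua, hwa] using h2 u (by simp [hua, hu]) w (by simp [hwa, hw]) huw
    · rw [Finset.not_nonempty_iff_eq_empty] at hS
      subst hS
      exact ⟨fun _ => Classical.arbitrary κ, by simp, by simp⟩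

/-- An edge leaves every nonempty proper subset, which gives a vertex whose degree inside is below
its list size; for `S` itself `u` serves. So greedy coloring applies. -/
theorem ConnIn.listColorable_of_lt [Nonempty κ] (hS : ConnIn G S)
    (hle : ∀ u ∈ S, degIn G S u ≤ (ℓ u).card) (hu : u ∈ S) (hlt : degIn G S u < (ℓ u).card) :
    ListColorable G S ℓ := by
  refine listColorable_of_degenerate fun A hA hne => ?_
  by_cases hAS : A = S
  · exact ⟨u, hAS ▸ hu, hAS ▸ hlt⟩
  · have := mt (hS.2 A hA hne) hAS
    push Not at this
    obtain ⟨a, ha, b, hb, hab, hbA⟩ := this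
    exact ⟨a, ha, (degIn_lt_of_adj hA hb hbA hab).trans_le (hle a (hA ha))⟩

theorem ConnIn.exists_adj_of_ne (hS : ConnIn G S) (hu : u ∈ S) (hw : w ∈ S) (h : u ≠ w) :
    ∃ b ∈ S, G.Adj u b := by
  by_contra! hc
  have := hS.2 {u} (by simpa using hu) (by simp) (by
    intro a ha b hb hab
    rw [Finset.mem_singleton] at ha
    exact absurd (ha ▸ hab) (hc b hb))
  rw [← this, Finset.mem_singleton] at hw
  exact h hw.symm

/-- A function that is constant along the edges of a connected set is constant. -/
theorem ConnIn.const {α : Type*} {g : V → α} (hS : ConnIn G S)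
    (h : ∀ a ∈ S, ∀ b ∈ S, G.Adj a b → g a = g b) (hu : u ∈ S) (hw : w ∈ S) : g u = g w := by
  classical
  have := hS.2 (S.filter fun a => g a = g w) (Finset.filter_subset _ _) ⟨w, by simp [hw]⟩
    (fun a ha b hb hab => by
      simp only [Finset.mem_filter] at ha ⊢
      exact ⟨hb, (h a ha.1 b hb hab).symm.trans ha.2⟩)
  rw [← this] at hu
  exact (Finset.mem_filter.1 hu).2

theorem connIn_insert [DecidableEq V] (hS : ConnIn G S) (hD : D ⊆ S) (hx : x ∈ S)
    (hrest : ∃ y ∈ S, y ≠ x ∧ y ∉ D) (hcl : ∀ a ∈ D, ∀ b ∈ S, G.Adj a b → b = x ∨ b ∈ D) :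
    ConnIn G (insert x D) := by
  refine ⟨by simp, fun A hA hne hAc => ?_⟩
  obtain ⟨y, hy, hyx, hyD⟩ := hrest
  by_cases hxA : x ∈ A
  · have := hS.2 (A ∪ (S \ insert x D)) (by grind) ⟨x, by simp [hxA]⟩ (by
      intro a ha b hb hab
      have h1 := hAc a
      have h2 := hcl b
      have := hab.symm
      grind)
    ext z
    have hz : z ∈ A ∪ (S \ insert x D) ↔ z ∈ S := by rw [this]
    grind
  · have := hS.2 A (by grind) hne (by
      intro a ha b hb hab
      have h1 := hAc a ha b
      have h2 := hcl a
      grind)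
    grind

theorem ConnIn.erase_leaf [DecidableEq V] (hS : ConnIn G S) (hx : x ∈ S) (hd : degIn G S x ≤ 1)
    (hne : (S.erase x).Nonempty) : ConnIn G (S.erase x) := by
  classical
  refine ⟨hne, fun A hA hAne hAc => ?_⟩
  by_cases h : ∃ a ∈ A, G.Adj x a
  · obtain ⟨a, ha, hxa⟩ := h
    have := hS.2 (insert x A) (by grind) (by simp) (by
      intro b hb z hz hbz
      rw [Finset.mem_insert] at hb ⊢
      rcases hb with rfl | hb
      · right
        have := Finset.card_le_one.1 hd z (by simp [hz, hbz]) a (by simp [hxa]; grind)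
        exact this ▸ ha
      · by_cases hzx : z = x
        · exact Or.inl hzx
        · exact Or.inr (hAc b hb z (by simp [hzx, hz]) hbz))
    ext z
    have hz : z ∈ insert x A ↔ z ∈ S := by rw [this]
    grind
  · push Not at h
    have := hS.2 A (by grind) hAne (by
      intro a ha b hb hab
      refine hAc a ha b (Finset.mem_erase.2 ⟨?_, hb⟩) hab
      rintro rfl
      exact h a ha hab.symm)
    grind

theorem IsLobe.compl [DecidableEq V] (h : IsLobe G S D x) : IsLobe G S (S \ insert x D) x where
  subset := Finset.sdiff_subset
  nonempty := by
    obtain ⟨y, hy, hyx, hyD⟩ := h.exists_rest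
    exact ⟨y, by simp [hy, hyx, hyD]⟩
  mem := h.mem
  notMem := by simp
  exists_rest := by
    obtain ⟨y, hy⟩ := h.nonempty
    exact ⟨y, h.subset hy, fun hyx => h.notMem (hyx ▸ hy), by simp [hy]⟩
  closed := by
    intro a ha b hb hab
    have h1 := h.closed b
    have := hab.symm
    grind

theorem IsLobe.insert_compl [DecidableEq V] (h : IsLobe G S D x) :
    insert x (S \ insert x D) = S \ D := by
  have := h.mem
  have := h.notMem
  ext z
  grind

theorem exists_isLobe_of_not_connIn_erase [DecidableEq V] (hu : u ∈ S)
    (hne : (S.erase u).Nonempty) (h : ¬ ConnIn G (S.erase u)) : ∃ D, IsLobe G S D u := by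
  unfold ConnIn at h
  push Not at h
  obtain ⟨A, hA, hAne, hAc, hAS⟩ := h hne
  refine ⟨A, by grind, hAne, hu, by grind, ?_, ?_⟩
  · obtain ⟨y, hy, hyA⟩ := Finset.exists_of_ssubset (hA.ssubset_of_ne hAS)
    exact ⟨y, by grind, by grind, hyA⟩
  · intro a ha b hb hab
    have := hAc a ha b
    grind

theorem IsBad.card_eq [Nonempty κ] (h : IsBad G S ℓ) (hu : u ∈ S) : (ℓ u).card = degIn G S u := by
  by_contra hne
  exact h.not_colorable (h.conn.listColorable_of_lt h.le hu
    (lt_of_le_of_ne (h.le u hu) (Ne.symm hne)))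

open Classical in
theorem IsBad.erase (h : IsBad G S ℓ) (hu : u ∈ S) (hc : ConnIn G (S.erase u))
    {c : κ} (hcu : c ∈ ℓ u) :
    IsBad G (S.erase u) (fun w => if G.Adj w u then (ℓ w).erase c else ℓ w) where
  conn := hc
  le := by
    intro w hw
    have h1 := h.le w (Finset.mem_of_mem_erase hw)
    rw [degIn_erase_add hu w] at h1
    split_ifs at h1 ⊢
    · have := Finset.pred_card_le_card_erase (s := ℓ w) (a := c)
      omega
    · exact h1
  not_colorable := by
    rintro ⟨φ, h1, h2⟩
    refine h.not_colorable ⟨Function.update φ u c, fun w hw => ?_, fun a ha b hb hab => ?_⟩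
    · by_cases hwu : w = u
      · simpa [hwu] using hcu
      · have : φ w ∈ if G.Adj w u then (ℓ w).erase c else ℓ w := h1 w (by simp [hw, hwu])
        simp only [hwu, ne_eq, not_false_eq_true, Function.update_of_ne]
        split_ifs at this
        · exact Finset.mem_of_mem_erase this
        · exact this
    · have key : ∀ w ∈ S, G.Adj w u → φ w ≠ c := by
        intro w hw hwu
        have : φ w ∈ if G.Adj w u then (ℓ w).erase c else ℓ w := h1 w (by simp [hw, hwu.ne])
        rw [if_pos hwu] at this
        exact Finset.ne_of_mem_erase this
      by_cases hau : a = u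
      · subst hau
        simpa [hab.ne'] using (key b hb hab.symm).symm
      · by_cases hbu : b = u
        · subst hbu
          simpa [hau] using key a ha hab
        · simpa [hau, hbu] using h2 a (by simp [ha, hau]) b (by simp [hb, hbu]) hab

/-- Give `u` a color `c` of its list. The rest stays bad, so list sizes still equal degrees; the
degree of `w` has dropped by one, so its list must have lost `c`. -/
theorem IsBad.subset_of_adj [Nonempty κ] [DecidableEq V] (h : IsBad G S ℓ) (hu : u ∈ S)
    (hc : ConnIn G (S.erase u)) (hw : w ∈ S) (ha : G.Adj u w) : ℓ u ⊆ ℓ w := by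
  classical
  intro c hcu
  have hw' : w ∈ S.erase u := by simp [hw, ha.ne']
  have h1 := IsBad.card_eq (by convert h.erase hu (by convert hc) hcu) hw'
  have h2 := h.card_eq hw
  rw [degIn_erase_add hu w, if_pos ha.symm] at h2
  rw [if_pos ha.symm] at h1
  by_contra hcw
  rw [Finset.erase_eq_of_notMem hcw] at h1
  have : degIn G (S.erase u) w + 1 = degIn G (S.erase u) w := by
    rw [← h2, h1]
  omega

/-- Each color of `x` fails on one of the two sides, as otherwise two colorings could be glued at
`x`. On a side `T` at most `degIn G T x` colors fail, since a longer list would leave slack at `x`.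
The two degrees add up to the degree of `x` in `S`, so both bounds are attained, and the failing
colors form the new lists. -/
theorem IsBad.split [Nonempty κ] [DecidableEq V] (h : IsBad G S ℓ) (hD : IsLobe G S D x) :
    ∃ M M' : Finset κ, IsBad G (insert x D) (Function.update ℓ x M) ∧
      IsBad G (S \ D) (Function.update ℓ x M') := by
  classical
  have hc1 : ConnIn G (insert x D) := connIn_insert h.conn hD.subset hD.mem hD.exists_rest hD.closed
  have hc2 : ConnIn G (S \ D) := by
    rw [← hD.insert_compl]
    exact connIn_insert h.conn hD.compl.subset hD.mem hD.compl.exists_rest hD.compl.closed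
  have hx2 : x ∈ S \ D := by simp [hD.mem, hD.notMem]
  have hs1 : insert x D ⊆ S := Finset.insert_subset hD.mem hD.subset
  let ext (T : Finset V) := (ℓ x).filter fun c => ListColorable G T (Function.update ℓ x {c})
  have unc : ∀ T : Finset V, x ∈ T →
      ¬ ListColorable G T (Function.update ℓ x (ℓ x \ ext T)) := by
    rintro T hx ⟨φ, h1, h2⟩
    have h3 := h1 x hx
    simp only [Function.update_self, Finset.mem_sdiff, ext, Finset.mem_filter, not_and] at h3
    refine h3.2 h3.1 ⟨φ, fun u hu => ?_, h2⟩
    by_cases hux : u = x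
    · simp [hux]
    · simpa [hux] using h1 u hu
  have upper : ∀ T : Finset V, x ∈ T → T ⊆ S → ConnIn G T → (ℓ x \ ext T).card ≤ degIn G T x := by
    intro T hx hT hc
    by_contra! hlt
    refine unc T hx (hc.listColorable_of_lt (fun u hu => ?_) hx (by simpa using hlt))
    by_cases hux : u = x
    · subst hux; simpa using hlt.le
    · simpa [hux] using (degIn_mono hT u).trans (h.le u (hT hu))
  have hu1 := upper _ (Finset.mem_insert_self x D) hs1 hc1
  have hu2 := upper _ hx2 Finset.sdiff_subset hc2
  have hdeg : degIn G S x = degIn G (insert x D) x + degIn G (S \ D) x := by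
    rw [degIn_congr (S := insert x D) (T := D) (fun b hb => by simp [hb.ne']),
      ← degIn_union Finset.disjoint_sdiff, Finset.union_sdiff_of_subset hD.subset]
  have hcov : ℓ x ⊆ (ℓ x \ ext (insert x D)) ∪ (ℓ x \ ext (S \ D)) := by
    intro c hc
    by_contra hcn
    simp only [Finset.mem_union, Finset.mem_sdiff, ext, Finset.mem_filter, not_or, not_and,
      not_forall, not_not] at hcn
    obtain ⟨⟨φ, h1, h2⟩, ⟨ψ, h3, h4⟩⟩ := And.intro (hcn.1 hc).2 (hcn.2 hc).2
    have hφx : φ x = c := by simpa using h1 x (by simp)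
    have hψx : ψ x = c := by simpa using h3 x hx2
    have hψ : ∀ b ∈ S \ D, (if b ∈ insert x D then φ b else ψ b) = ψ b := by
      intro b hb
      split_ifs with hbx
      · rcases Finset.mem_insert.1 hbx with rfl | hbD
        · rw [hφx, hψx]
        · exact absurd hbD (Finset.mem_sdiff.1 hb).2
      · rfl
    have hl : ∀ (T : Finset V) (χ : V → κ), (∀ u ∈ T, χ u ∈ Function.update ℓ x {c} u) →
        ∀ u ∈ T, χ u ∈ ℓ u := by
      intro T χ hχ u hu
      have := hχ u hu
      by_cases hux : u = x
      · subst hux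
        simp only [Function.update_self, Finset.mem_singleton] at this
        exact this ▸ hc
      · simpa [hux] using this
    refine h.not_colorable ⟨fun b => if b ∈ insert x D then φ b else ψ b, fun u hu => ?_, ?_⟩
    · by_cases hux : u ∈ insert x D
      · simpa only [if_pos hux] using hl _ φ h1 u hux
      · simp only [if_neg hux]
        exact hl _ ψ h3 u (by grind)
    · intro a ha b hb hab
      have h5 := hD.closed a
      have h6 := hD.closed b
      have hba := hab.symm
      by_cases hboth : a ∈ insert x D ∧ b ∈ insert x D
      · simpa only [if_pos hboth.1, if_pos hboth.2] using h2 a hboth.1 b hboth.2 hab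
      · have ha' : a ∈ S \ D := by grind
        have hb' : b ∈ S \ D := by grind
        simpa only [hψ a ha', hψ b hb'] using h4 a ha' b hb' hab
  have hcard := (Finset.card_le_card hcov).trans (Finset.card_union_le _ _)
  have hSx := h.le x hD.mem
  have mk : ∀ T : Finset V, x ∈ T → T ⊆ S → ConnIn G T → degIn G T x ≤ (ℓ x \ ext T).card →
      IsBad G T (Function.update ℓ x (ℓ x \ ext T)) := by
    refine fun T hx hT hc hle => ⟨hc, fun u hu => ?_, unc T hx⟩
    by_cases hux : u = x
    · subst hux; simpa using hle
    · simpa [hux] using (degIn_mono hT u).trans (h.le u (hT hu))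
  exact ⟨_, _, mk _ (Finset.mem_insert_self x D) hs1 hc1 (by omega),
    mk _ hx2 Finset.sdiff_subset hc2 (by omega)⟩

end ListColoring

/-! ### Gallai's bound on the average degree of bad sets -/

section GallaiBound

variable {V κ : Type*} {G : SimpleGraph V} {S T D : Finset V} {ℓ : V → Finset κ} {u w x : V}

/-- An inclusion-minimal lobe. -/
structure IsMinLobe (G : SimpleGraph V) (S D : Finset V) (x : V) : Prop extends
    IsLobe G S D x where
  minimal : ∀ D' y, D' ⊂ D → ¬ IsLobe G S D' y

theorem IsLobe.exists_isMinLobe (h : IsLobe G S D x) :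
    ∃ D' ⊆ D, ∃ y, IsMinLobe G S D' y := by
  induction D using Finset.strongInduction generalizing x with
  | H D ih =>
    by_cases hm : ∀ D' y, D' ⊂ D → ¬ IsLobe G S D' y
    · exact ⟨D, subset_rfl, x, h, hm⟩
    · push Not at hm
      obtain ⟨D', y, hD', hy⟩ := hm
      obtain ⟨D'', h1, h2⟩ := ih D' hD' hy
      exact ⟨D'', h1.trans hD'.subset, h2⟩

theorem IsMinLobe.conn (h : IsMinLobe G S D x) : ConnIn G D := by
  refine ⟨h.nonempty, fun A hA hne hAc => ?_⟩
  by_contra hAD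
  obtain ⟨y, hy, hyx, hyD⟩ := h.exists_rest
  refine h.minimal A x (hA.ssubset_of_ne hAD) ⟨hA.trans h.subset, hne, h.mem,
    fun hx => h.notMem (hA hx), ⟨y, hy, hyx, fun hyA => hyD (hA hyA)⟩, fun a ha b hb hab => ?_⟩
  exact (h.closed a (hA ha) b hb hab).imp_right fun hbD => hAc a ha b hbD hab

/-- If `u` were a cut vertex, a lobe at `u` avoiding `x` would lie in `D` without `u`, against
minimality. -/
theorem IsMinLobe.connIn_erase [DecidableEq V] (h : IsMinLobe G S D x) (hS : ConnIn G S)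
    (hu : u ∈ D) : ConnIn G (S.erase u) := by
  by_contra hc
  have hux : x ≠ u := by rintro rfl; exact h.notMem hu
  obtain ⟨A₀, hA₀⟩ := exists_isLobe_of_not_connIn_erase (h.subset hu)
    ⟨x, Finset.mem_erase.2 ⟨hux, h.mem⟩⟩ hc
  obtain ⟨A, hA, hxA⟩ : ∃ A, IsLobe G S A u ∧ x ∉ A := by
    by_cases hx : x ∈ A₀
    · exact ⟨_, hA₀.compl, by simp [hx]⟩
    · exact ⟨_, hA₀, hx⟩
  have hAD : A ⊆ D := by
    by_contra hAD
    have hAS := hA.subset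
    have := hS.2 (A \ D) (by grind) (by rwa [Finset.sdiff_nonempty]) (by
      intro a ha b hb hab
      have h1 := hA.closed a (by grind) b hb hab
      have h2 := h.closed b
      have h3 := hab.symm
      have h4 := h.closed u hu a (by grind)
      grind)
    have := h.mem
    grind
  have huA := hA.notMem
  exact h.minimal A u (hAD.ssubset_of_ne (by grind)) hA

theorem IsBad.eq_of_isMinLobe [Nonempty κ] (hb : IsBad G S ℓ) (h : IsMinLobe G S D x)
    (hu : u ∈ D) (hw : w ∈ D) : ℓ u = ℓ w := by
  classical
  refine h.conn.const (fun a ha b hbD hab => ?_) hu hw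
  exact (hb.subset_of_adj (h.subset ha) (h.connIn_erase hb.conn ha) (h.subset hbD) hab).antisymm
    (hb.subset_of_adj (h.subset hbD) (h.connIn_erase hb.conn hbD) (h.subset ha) hab.symm)

theorem IsMinLobe.exists_adj (h : IsMinLobe G S D x) (hS : ConnIn G S) :
    ∃ u ∈ D, G.Adj u x := by
  by_contra! hc
  have := hS.2 D h.subset h.nonempty fun a ha b hb hab =>
    (h.closed a ha b hb hab).resolve_left fun hbx => hc a ha (hbx ▸ hab)
  exact h.notMem (this ▸ h.mem)

/-- The root of a minimal lobe has at least as many neighbors in the lobe as the vertices of the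
lobe have in total. -/
theorem IsBad.card_le_degIn_root [Nonempty κ] (hb : IsBad G S ℓ) (h : IsMinLobe G S D x)
    (hw : w ∈ D) : (ℓ w).card ≤ degIn G D x := by
  classical
  obtain ⟨u, hu, hux⟩ := h.exists_adj hb.conn
  -- In the bad part `insert x D` the neighbor `u` of `x` is not a cut vertex, so its list is
  -- contained in `M`, which has `degIn G D x` colors.
  obtain ⟨M, M', h1, -⟩ := hb.split h.toIsLobe
  have hxu : x ≠ u := hux.ne'
  have hconn : ConnIn G ((insert x D).erase u) := by
    rw [Finset.erase_insert_of_ne hxu]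
    obtain ⟨y, hy, hyx, hyD⟩ := h.exists_rest
    refine connIn_insert (h.connIn_erase hb.conn hu) (Finset.erase_subset_erase _ h.subset)
      (Finset.mem_erase.2 ⟨hxu, h.mem⟩) ⟨y, ?_, hyx, ?_⟩ fun a ha b hb' hab => ?_
    · simp only [Finset.mem_erase, hy, and_true]
      rintro rfl
      exact hyD hu
    · simp [hyD]
    · have := h.closed a (Finset.mem_of_mem_erase ha) b (Finset.mem_of_mem_erase hb') hab
      exact this.imp_right fun hbD => Finset.mem_erase.2 ⟨Finset.ne_of_mem_erase hb', hbD⟩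
  have hsub := h1.subset_of_adj (Finset.mem_insert_of_mem hu) hconn (Finset.mem_insert_self x D) hux
  have hcard := h1.card_eq (Finset.mem_insert_self x D)
  rw [Function.update_of_ne hxu.symm, Function.update_self] at hsub
  rw [Function.update_self, degIn_congr (T := D) (fun b hb => by simp [hb.ne'])] at hcard
  rw [hb.eq_of_isMinLobe h hw hu, ← hcard]
  exact Finset.card_le_card hsub

theorem IsBad.card_le_card_lobe [Nonempty κ] (hb : IsBad G S ℓ) (h : IsLobe G S D x)
    (hw : w ∈ D) : (ℓ w).card ≤ D.card := by
  classical
  rw [hb.card_eq (h.subset hw), degIn_congr (T := insert x D) (fun b hwb => ?_)]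
  · have := degIn_lt_card (G := G) (Finset.mem_insert_of_mem (b := x) hw)
    rw [Finset.card_insert_of_notMem h.notMem] at this
    omega
  · refine ⟨fun hbS => ?_, fun hbS => Finset.insert_subset h.mem h.subset hbS⟩
    simpa using h.closed w hw b hbS hwb

theorem sum_degIn_lobe [DecidableEq V] (h : IsLobe G S D x) :
    ∑ u ∈ S, degIn G S u =
      ∑ u ∈ D, degIn G S u + ∑ u ∈ S \ D, degIn G (S \ D) u + degIn G D x := by
  have hx : x ∈ S \ D := by simp [h.mem, h.notMem]
  rw [← Finset.sum_sdiff h.subset, ← Finset.add_sum_erase _ _ hx, ← Finset.add_sum_erase _ _ hx]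
  have h1 : degIn G S x = degIn G (S \ D) x + degIn G D x := by
    rw [← degIn_union Finset.sdiff_disjoint, Finset.sdiff_union_of_subset h.subset]
  have h2 : ∑ u ∈ (S \ D).erase x, degIn G S u = ∑ u ∈ (S \ D).erase x, degIn G (S \ D) u := by
    refine Finset.sum_congr rfl fun u hu => degIn_congr fun b hub => ?_
    have := h.closed b
    have := hub.symm
    grind
  rw [h1, h2]
  ring

/-- A connected set without cut vertices that induces a regular graph of the maximal degree can be
colored, unless it is a clique. -/
theorem IsBad.exists_degree_lt [Nonempty κ] {Δ : ℕ} (hΔ : 3 ≤ Δ) (hclique : G.CliqueFree (Δ + 1))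
    (hb : IsBad G S ℓ) (hno : ∀ D x, ¬ IsLobe G S D x) (hdeg : ∀ u ∈ S, degIn G S u = Δ) :
    False := by
  classical
  have hconn : ∀ u ∈ S, ConnIn G (S.erase u) := by
    intro u hu
    by_contra hc
    have hpos : (S.filter (G.Adj u)).Nonempty := by
      rw [← Finset.card_pos]
      have := hdeg u hu
      unfold degIn at this
      convert (show 0 < Δ by omega) using 1
    obtain ⟨w, hw⟩ := hpos
    rw [Finset.mem_filter] at hw
    obtain ⟨D, hD⟩ := exists_isLobe_of_not_connIn_erase hu
      ⟨w, Finset.mem_erase.2 ⟨hw.2.ne', hw.1⟩⟩ hc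
    exact hno D u hD
  obtain ⟨u, hu⟩ := hb.conn.1
  have hcardu : (ℓ u).card = Δ := by rw [hb.card_eq hu, hdeg u hu]
  obtain ⟨c, hc⟩ : (ℓ u).Nonempty := by rw [← Finset.card_pos]; omega
  have hall : ∀ w ∈ S, ℓ w = ℓ u := fun w hw => hb.conn.const (fun a ha b hb' hab =>
    (hb.subset_of_adj ha (hconn a ha) hb' hab).antisymm
      (hb.subset_of_adj hb' (hconn b hb') ha hab.symm)) hw hu
  have hK := hb.erase hu (by convert hconn u hu) hc
  set ℓ' : V → Finset κ := fun w => if G.Adj w u then (ℓ w).erase c else ℓ w with hℓ'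
  -- All lists were equal; after coloring `u`, exactly its neighbors lack `c`. So vertices with
  -- equal reduced lists are all neighbors of `u` or all non-neighbors.
  have hadj : ∀ a ∈ S, ∀ b ∈ S, ℓ' a = ℓ' b → G.Adj a u → G.Adj b u := by
    intro a ha b hb' hab hau
    by_contra hbu
    have : c ∈ ℓ' b := by simp only [hℓ', if_neg hbu]; rwa [hall b hb']
    rw [← hab] at this
    simp [hℓ', if_pos hau] at this
  have hsubS : ∀ D : Finset V, (∀ w ∈ D, w ∈ S ∧ G.Adj w u) → D.card ≤ Δ := by
    intro D hD
    rw [← hdeg u hu]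
    refine Finset.card_le_card fun w hw => ?_
    exact Finset.mem_filter.2 ⟨(hD w hw).1, (hD w hw).2.symm⟩
  obtain ⟨v, hv, huv⟩ : ∃ v ∈ S, G.Adj u v := by
    have h1 : ∃ v ∈ S, u ≠ v := by
      have := degIn_lt_card (G := G) hu
      rw [hdeg u hu] at this
      obtain ⟨v, hv, hne⟩ := Finset.exists_mem_ne (by omega : 1 < S.card) u
      exact ⟨v, hv, hne.symm⟩
    obtain ⟨v, hv, hne⟩ := h1
    exact hb.conn.exists_adj_of_ne hu hv hne
  by_cases hlobe : ∃ D x, IsLobe G (S.erase u) D x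
  · obtain ⟨D, x, hD⟩ := hlobe
    -- A minimal lobe of `S \ {u}` meets the neighborhood of `u`, since otherwise it would be a lobe
    -- of `S`; its lists being equal, it lies inside. Lists of size `Δ - 1` force at least `Δ - 1`
    -- vertices, and two disjoint such lobes exceed the degree of `u`.
    have main : ∀ D x, IsMinLobe G (S.erase u) D x →
        (∀ w ∈ D, w ∈ S ∧ G.Adj w u) ∧ Δ ≤ D.card + 1 := by
      intro D x hD
      have hDS : D ⊆ S := hD.subset.trans (Finset.erase_subset _ _)
      obtain ⟨a, ha, hau⟩ : ∃ a ∈ D, G.Adj a u := by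
        by_contra! hcon
        refine hno D x ⟨hDS, hD.nonempty, Finset.mem_of_mem_erase hD.mem, hD.notMem, ?_, ?_⟩
        · obtain ⟨y, hy, hy'⟩ := hD.exists_rest
          exact ⟨y, Finset.mem_of_mem_erase hy, hy'⟩
        · intro a ha b hb' hab
          refine hD.closed a ha b (Finset.mem_erase.2 ⟨?_, hb'⟩) hab
          rintro rfl
          exact hcon a ha hab
      have hD' : ∀ w ∈ D, w ∈ S ∧ G.Adj w u := fun w hw =>
        ⟨hDS hw, hadj a (hDS ha) w (hDS hw) (hK.eq_of_isMinLobe hD ha hw) hau⟩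
      refine ⟨hD', ?_⟩
      have h1 := hK.card_le_card_lobe hD.toIsLobe ha
      simp only [hℓ', if_pos hau] at h1
      have h2 := Finset.pred_card_le_card_erase (s := ℓ a) (a := c)
      rw [hall a (hDS ha)] at h1 h2
      omega
    obtain ⟨D₁, h1, x₁, hD₁⟩ := hD.exists_isMinLobe
    obtain ⟨D₂, h2, x₂, hD₂⟩ := hD.compl.exists_isMinLobe
    have hdisj : Disjoint D₁ D₂ := by
      rw [Finset.disjoint_left]
      intro a ha ha'
      have := h1 ha
      have := h2 ha'
      grind
    have h3 := hsubS (D₁ ∪ D₂) fun w hw => (Finset.mem_union.1 hw).elim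
      ((main D₁ x₁ hD₁).1 w) ((main D₂ x₂ hD₂).1 w)
    rw [Finset.card_union_of_disjoint hdisj] at h3
    have := (main D₁ x₁ hD₁).2
    have := (main D₂ x₂ hD₂).2
    omega
  -- Without lobes the reduced lists are all equal, so `u` is adjacent to all of `S \ {u}` and `S`
  -- is a clique with `Δ + 1` vertices.
  · push Not at hlobe
    have hconn' : ∀ a ∈ S.erase u, ∀ b ∈ S.erase u, G.Adj a b → ℓ' a ⊆ ℓ' b := by
      intro a ha b hb' hab
      refine hK.subset_of_adj ha ?_ hb' hab
      by_contra hc'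
      obtain ⟨D, hD⟩ := exists_isLobe_of_not_connIn_erase ha
        ⟨b, Finset.mem_erase.2 ⟨hab.ne', hb'⟩⟩ hc'
      exact hlobe D a hD
    have hv' : v ∈ S.erase u := Finset.mem_erase.2 ⟨huv.ne', hv⟩
    have hall' : ∀ w ∈ S.erase u, G.Adj w u := by
      intro w hw
      refine hadj v hv w (Finset.mem_of_mem_erase hw) ?_ huv.symm
      exact hK.conn.const (fun a ha b hb' hab =>
        (hconn' a ha b hb' hab).antisymm (hconn' b hb' a ha hab.symm)) hv' hw
    have hcard : S.card = Δ + 1 := by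
      have h1 := hsubS (S.erase u) fun w hw => ⟨Finset.mem_of_mem_erase hw, hall' w hw⟩
      have h2 := degIn_lt_card (G := G) hu
      rw [Finset.card_erase_of_mem hu] at h1
      rw [hdeg u hu] at h2
      omega
    refine hclique S ⟨fun a ha b hb' hab => ?_, hcard⟩
    have h1 : S.filter (G.Adj a) = S.erase a := by
      refine Finset.eq_of_subset_of_card_le (fun y hy => ?_) ?_
      · rw [Finset.mem_filter] at hy
        exact Finset.mem_erase.2 ⟨hy.2.ne', hy.1⟩
      · rw [Finset.card_erase_of_mem ha, hcard, Nat.add_sub_cancel, ← hdeg a ha]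
        exact le_of_eq (by unfold degIn; congr)
    have h2 : b ∈ S.erase a := Finset.mem_erase.2 ⟨fun h => hab h.symm, hb'⟩
    rw [← h1] at h2
    exact (Finset.mem_filter.1 h2).2

/-- Gallai's bound on the number of edges of a connected set that is not degree-choosable. -/
theorem IsBad.three_mul_sum_degIn_le [Nonempty κ] {Δ : ℕ} (hΔ : 3 ≤ Δ)
    (hclique : G.CliqueFree (Δ + 1)) (hdeg : ∀ u T, degIn G T u ≤ Δ) (hb : IsBad G S ℓ) :
    3 * ∑ u ∈ S, degIn G S u + S.card ≤ 3 * Δ * S.card := by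
  classical
  induction S using Finset.strongInduction generalizing ℓ with
  | H S ih =>
    by_cases hno : ∀ D x, ¬ IsLobe G S D x
    · have hreg : ∃ k < Δ, ∀ u ∈ S, degIn G S u = k := by
        obtain ⟨u, hu⟩ := hb.conn.1
        have hk : ∀ w ∈ S, degIn G S w = degIn G S u := by
          have hsub : ∀ a ∈ S, ∀ b ∈ S, G.Adj a b → ℓ a ⊆ ℓ b := by
            intro a ha b hb' hab
            refine hb.subset_of_adj ha ?_ hb' hab
            by_contra hc
            obtain ⟨D, hD⟩ := exists_isLobe_of_not_connIn_erase ha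
              ⟨b, Finset.mem_erase.2 ⟨hab.ne', hb'⟩⟩ hc
            exact hno D a hD
          intro w hw
          rw [← hb.card_eq hw, ← hb.card_eq hu]
          exact hb.conn.const (g := fun a => (ℓ a).card) (fun a ha b hb' hab => congrArg _
            ((hsub a ha b hb' hab).antisymm (hsub b hb' a ha hab.symm))) hw hu
        refine ⟨_, lt_of_le_of_ne (hdeg u S) fun he => ?_, hk⟩
        exact hb.exists_degree_lt hΔ hclique hno fun w hw => (hk w hw).trans he
      obtain ⟨k, hkΔ, hk⟩ := hreg
      rw [Finset.sum_congr rfl hk, Finset.sum_const, smul_eq_mul]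
      obtain ⟨m, rfl⟩ := Nat.exists_eq_add_of_lt hkΔ
      nlinarith [Nat.zero_le (m * S.card)]
    · push Not at hno
      obtain ⟨D₀, x₀, h₀⟩ := hno
      obtain ⟨D, -, x, hD⟩ := h₀.exists_isMinLobe
      obtain ⟨-, M', -, hT⟩ := hb.split hD.toIsLobe
      obtain ⟨a, ha⟩ := hD.nonempty
      have hDk : ∀ w ∈ D, degIn G S w = degIn G S a := fun w hw => by
        rw [← hb.card_eq (hD.subset hw), ← hb.card_eq (hD.subset ha), hb.eq_of_isMinLobe hD hw ha]
      -- The common degree `k` on `D` is at most `|D|` and at most the number of neighbors of `x` in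
      -- `D`; as `x` also has a neighbor outside `D`, `k ≤ Δ - 1`.
      have hroot := hb.card_le_degIn_root hD ha
      have hcardD := hb.card_le_card_lobe hD.toIsLobe ha
      rw [hb.card_eq (hD.subset ha)] at hroot hcardD
      have hx : x ∈ S \ D := by simp [hD.mem, hD.notMem]
      have hxsum : degIn G (S \ D) x + degIn G D x ≤ Δ := by
        rw [← degIn_union Finset.sdiff_disjoint]
        exact hdeg _ _
      have hWne : ((S \ D).erase x).Nonempty := by
        obtain ⟨y, hy, hyx, hyD⟩ := hD.exists_rest
        exact ⟨y, by simp [hy, hyx, hyD]⟩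
      have hxpos : 0 < degIn G (S \ D) x := by
        obtain ⟨y, hy⟩ := hWne
        obtain ⟨z, hz, hxz⟩ := hT.conn.exists_adj_of_ne hx (Finset.mem_of_mem_erase hy)
          (Finset.ne_of_mem_erase hy).symm
        exact Finset.card_pos.2 ⟨z, by simpa [hxz] using hz⟩
      have hTS : S \ D ⊂ S := Finset.sdiff_ssubset hD.subset hD.nonempty
      have hcardS : S.card = D.card + (S \ D).card := by
        rw [Finset.card_sdiff_of_subset hD.subset]
        have := Finset.card_le_card hD.subset
        omega
      have hroot' : degIn G D x ≤ D.card := Finset.card_filter_le _ _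
      rw [sum_degIn_lobe hD.toIsLobe, Finset.sum_congr rfl hDk, Finset.sum_const, smul_eq_mul]
      have ihT := ih _ hTS hT
      -- If `k ≤ Δ - 2`, removing `D` lowers the degree sum by at most `(k + 1)|D| ≤ (Δ - 1)|D|`. If
      -- `k = Δ - 1`, then `x` is a leaf of `S \ D` and is removed too, which lowers the sum by `(Δ
      -- - 1)|D| + Δ + 1`. This fits because `|D| ≥ Δ - 1 ≥ 2`; the case `|D| = 2` is tight and
      -- dictates the factor `3`.
      by_cases hk : degIn G S a + 2 ≤ Δ
      · obtain ⟨m, rfl⟩ := Nat.exists_eq_add_of_le hk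
        rw [hcardS]
        nlinarith [Nat.zero_le (m * D.card)]
      · have hleaf : degIn G (S \ D) x ≤ 1 := by omega
        obtain ⟨c, hc⟩ : (Function.update ℓ x M' x).Nonempty := by
          rw [← Finset.card_pos, hT.card_eq hx]; exact hxpos
        have hW := hT.erase hx (by convert hT.conn.erase_leaf hx hleaf hWne) hc
        have ihW := ih _ ((Finset.erase_ssubset hx).trans hTS) (by convert hW)
        have hcardT : (S \ D).card = ((S \ D).erase x).card + 1 := by
          rw [Finset.card_erase_of_mem hx]
          have := Finset.card_pos.2 ⟨x, hx⟩
          omega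
        have hkΔ : degIn G S a + 1 = Δ := by omega
        rw [sum_degIn_erase hx, hcardS, hcardT]
        subst hkΔ
        nlinarith

end GallaiBound

/-! ### Balls in graphs -/

section Balls

variable {V : Type*} {G H : SimpleGraph V} {v w x y z : V} {r s : ℕ}

theorem mem_closedNbhd_self (G : SimpleGraph V) (v : V) (r : ℕ) : v ∈ closedNbhd G v r := by
  simp [closedNbhd]

theorem mem_closedNbhd_comm : w ∈ closedNbhd G v r ↔ v ∈ closedNbhd G w r := by
  simp [closedNbhd, SimpleGraph.edist_comm]

theorem closedNbhd_mono (h : r ≤ s) (v : V) : closedNbhd G v r ⊆ closedNbhd G v s :=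
  fun _ hw => le_trans (α := ℕ∞) hw (by exact_mod_cast h)

theorem mem_closedNbhd_add (hx : x ∈ closedNbhd G v r) (hy : y ∈ closedNbhd G x s) :
    y ∈ closedNbhd G v (r + s) := by
  have := (SimpleGraph.edist_triangle (G := G) (u := v) (v := x) (w := y)).trans
    (add_le_add (show _ ≤ (r : ℕ∞) from hx) (show _ ≤ (s : ℕ∞) from hy))
  simpa [closedNbhd] using this

theorem mem_closedNbhd_one (h : G.Adj v w) : w ∈ closedNbhd G v 1 := by
  simp [closedNbhd, SimpleGraph.edist_eq_one_iff_adj.2 h]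

theorem mem_closedNbhd_succ_of_adj (hx : x ∈ closedNbhd G v r) (h : G.Adj x y) :
    y ∈ closedNbhd G v (r + 1) :=
  mem_closedNbhd_add hx (mem_closedNbhd_one h)

theorem exists_walk_of_mem_closedNbhd (h : w ∈ closedNbhd G v r) :
    ∃ p : G.Walk v w, p.length ≤ r := by
  have h' : G.edist v w ≤ r := h
  obtain ⟨p, hp⟩ := SimpleGraph.exists_walk_of_edist_ne_top (G := G) (u := v) (v := w)
    (ne_top_of_le_ne_top (ENat.natCast_ne_top r) h')
  rw [← hp] at h'
  exact ⟨p, by exact_mod_cast h'⟩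

theorem mem_closedNbhd_of_walk (p : G.Walk v w) (h : p.length ≤ r) : w ∈ closedNbhd G v r :=
  (SimpleGraph.edist_le p).trans (by exact_mod_cast h)

/-- Induction on the radius of a ball. -/
theorem closedNbhd_induction {p : ℕ → V → Prop} (h0 : ∀ r, p r v)
    (hs : ∀ r x y, x ∈ closedNbhd G v r → p r x → G.Adj x y → p (r + 1) y)
    (hw : w ∈ closedNbhd G v r) : p r w := by
  have key : ∀ n r w (q : G.Walk v w), q.length = n → n ≤ r → p r w := by
    intro n
    induction n with
    | zero =>
      intro r w q hq _
      obtain rfl := SimpleGraph.Walk.eq_of_length_eq_zero hq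
      exact h0 r
    | succ n ih =>
      intro r w q hq hr
      obtain ⟨r, rfl⟩ : ∃ r', r = r' + 1 := ⟨r - 1, by omega⟩
      have hnil : ¬ q.Nil := by
        rw [← SimpleGraph.Walk.length_eq_zero_iff]
        omega
      have hl : q.dropLast.length = n := by
        rw [SimpleGraph.Walk.length_dropLast, hq, Nat.add_sub_cancel]
      exact hs r _ w (mem_closedNbhd_of_walk q.dropLast (by omega))
        (ih r _ q.dropLast hl (by omega)) (q.adj_penultimate hnil)
  obtain ⟨q, hq⟩ := exists_walk_of_mem_closedNbhd hw
  exact key _ r w q rfl hq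

theorem connIn_closedNbhd [Finite V] (G : SimpleGraph V) (v : V) (r : ℕ) :
    ConnIn G (Set.toFinite (closedNbhd G v r)).toFinset := by
  refine ⟨⟨v, by simpa using mem_closedNbhd_self G v r⟩, fun A hA ⟨a, ha⟩ hcl => ?_⟩
  simp only [Set.Finite.mem_toFinset] at hcl
  have hA' : ∀ b ∈ A, b ∈ closedNbhd G v r := fun b hb => by simpa using hA hb
  have back : ∀ s w, w ∈ closedNbhd G v s → s ≤ r → (w ∈ A → v ∈ A) := by
    intro s w hw hs
    refine closedNbhd_induction (p := fun s w => s ≤ r → (w ∈ A → v ∈ A)) (fun _ _ h => h)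
      (fun s x y hx ih hxy hs hy => ih (by omega) ?_) hw hs
    exact hcl y hy x (closedNbhd_mono (by omega) v hx) hxy.symm
  have hv : v ∈ A := back r a (hA' a ha) le_rfl ha
  refine hA.antisymm fun w hw => ?_
  rw [Set.Finite.mem_toFinset] at hw
  refine closedNbhd_induction (p := fun s w => s ≤ r → w ∈ A) (fun _ _ => hv)
    (fun s x y hx ih hxy hs => hcl x (ih (by omega)) y ?_ hxy) hw le_rfl
  exact closedNbhd_mono hs v (mem_closedNbhd_succ_of_adj hx hxy)

end Balls

/-- The hypotheses on the graphs: maximum degree at most `Δ`, no clique with `Δ + 1` vertices, and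
growth bounded by `f`. -/
structure IsBrooksGraph (Δ : ℕ) (f : ℕ → ℕ) {V : Type u} (G : SimpleGraph V) : Prop where
  degree_le : ∀ v, (G.neighborSet v).encard ≤ (Δ : ℕ∞)
  cliqueFree : G.CliqueFree (Δ + 1)
  growth : BoundsGrowth f G

/-! ### Extending a partial coloring inside a ball of bounded radius -/

section LocalBrooks

/-- `σ` is a proper coloring of the vertices on which it is defined. -/
def IsPartialColoring {V κ : Type*} (G : SimpleGraph V) (σ : V → Option κ) : Prop :=
  ∀ x y, G.Adj x y → σ x ≠ none → σ x ≠ σ y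

/-- Replacing `σ` by `τ` in the ball of radius `R` around `v` keeps the coloring proper, uncolors
no vertex and colors `v`. -/
structure IsRecoloring {V κ : Type*} (G : SimpleGraph V) (R : ℕ) (σ : V → Option κ) (v : V)
    (τ : V → Option κ) : Prop where
  ne_none : ∀ y ∈ closedNbhd G v R, σ y ≠ none → τ y ≠ none
  center : τ v ≠ none
  inside : ∀ y ∈ closedNbhd G v R, ∀ z ∈ closedNbhd G v R, G.Adj y z → τ y ≠ none → τ y ≠ τ z
  boundary : ∀ y ∈ closedNbhd G v R, ∀ z ∉ closedNbhd G v R, G.Adj y z → τ y ≠ none → τ y ≠ σ z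

variable {V : Type*} {G : SimpleGraph V} {Δ : ℕ} {f : ℕ → ℕ}

theorem IsBrooksGraph.degIn_le (hG : IsBrooksGraph Δ f G) (u : V) (T : Finset V) :
    degIn G T u ≤ Δ := by
  classical
  have h : ((T.filter (G.Adj u) : Finset V) : Set V) ⊆ G.neighborSet u := by
    intro w hw
    simp only [Finset.coe_filter, Set.mem_ofPred_eq] at hw
    exact hw.2
  have := (Set.encard_le_encard h).trans (hG.degree_le u)
  rw [Set.encard_coe_eq_coe_finsetCard] at this
  unfold degIn
  convert (show (T.filter (G.Adj u)).card ≤ Δ by exact_mod_cast this)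

open Classical in
/-- The colors that a vertex may use if the vertices outside of `S` keep theirs. -/
def freeColors (G : SimpleGraph V) (σ : V → Option (Fin Δ)) (S : Finset V) (u : V) :
    Finset (Fin Δ) :=
  Finset.univ.filter fun c => ∀ w ∉ S, G.Adj u w → σ w ≠ some c

theorem IsBrooksGraph.degIn_le_card_freeColors [Finite V] (hG : IsBrooksGraph Δ f G)
    (σ : V → Option (Fin Δ)) (S : Finset V) (u : V) :
    degIn G S u ≤ (freeColors G σ S u).card := by
  classical
  have := Fintype.ofFinite V
  have h1 : degIn G S u + degIn G Sᶜ u ≤ Δ := by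
    rw [← degIn_union disjoint_compl_right]
    exact hG.degIn_le _ _
  have h2 : (freeColors G σ S u)ᶜ.card ≤ degIn G Sᶜ u := by
    have : (freeColors G σ S u)ᶜ.map Function.Embedding.some ⊆
        (Sᶜ.filter (G.Adj u)).image σ := by
      intro o ho
      simp only [Finset.mem_map, Finset.mem_compl, freeColors, Finset.mem_filter,
        Finset.mem_univ, true_and] at ho
      push Not at ho
      obtain ⟨c, ⟨w, hw, huw, hc⟩, rfl⟩ := ho
      exact Finset.mem_image.2 ⟨w, by simp [hw, huw], hc⟩
    have := (Finset.card_le_card this).trans Finset.card_image_le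
    rw [Finset.card_map] at this
    unfold degIn
    convert this
  have h3 := Finset.card_compl_add_card (freeColors G σ S u)
  rw [Fintype.card_fin] at h3
  omega

theorem isRecoloring_of_listColorable {σ : V → Option (Fin Δ)} (hσ : IsPartialColoring G σ)
    {S : Finset V} {v : V} {R : ℕ} (hS : ∀ y ∈ S, y ∈ closedNbhd G v R) (hv : v ∈ S)
    (h : ListColorable G S (freeColors G σ S)) : ∃ τ, IsRecoloring G R σ v τ := by
  classical
  obtain ⟨φ, h1, h2⟩ := h
  simp only [freeColors, Finset.mem_filter, Finset.mem_univ, true_and] at h1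
  have hproper : IsPartialColoring G (fun y => if y ∈ S then some (φ y) else σ y) := by
    intro x y hxy hx
    by_cases hxS : x ∈ S <;> by_cases hyS : y ∈ S
    · simpa [hxS, hyS] using h2 x hxS y hyS hxy
    · simpa [hxS, hyS] using (h1 x hxS y hyS hxy).symm
    · simpa [hxS, hyS] using h1 y hyS x hxS hxy.symm
    · simp only [if_neg hxS, if_neg hyS] at hx ⊢
      exact hσ x y hxy hx
  refine ⟨_, fun y _ hy => ?_, by simp [hv], fun y _ z _ hyz hy => hproper y z hyz hy,
    fun y _ z hz hyz hy => ?_⟩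
  · by_cases hyS : y ∈ S <;> simp [hyS, hy]
  · have := hproper y z hyz hy
    simpa only [if_neg fun hzS => hz (hS z hzS)] using this

/-- In a Brooks graph of slow growth, every partial coloring can be extended to a given vertex by
changing it only in a ball of bounded radius. -/
theorem IsBrooksGraph.exists_isRecoloring [Finite V] (hG : IsBrooksGraph Δ f G) (hΔ : 3 ≤ Δ) {R : ℕ}
    (hR : f R * (3 * Δ - 1) ^ R ≤ (3 * Δ) ^ R) {σ : V → Option (Fin Δ)}
    (hσ : IsPartialColoring G σ) (v : V) : ∃ τ, IsRecoloring G R σ v τ := by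
  classical
  by_contra hno
  have : Nonempty (Fin Δ) := ⟨⟨0, by omega⟩⟩
  let S : ℕ → Finset V := fun r => (Set.toFinite (closedNbhd G v r)).toFinset
  have hmem : ∀ r y, y ∈ S r ↔ y ∈ closedNbhd G v r := fun r y => by simp [S]
  have hbad : ∀ r ≤ R, IsBad G (S r) (freeColors G σ (S r)) := fun r hr =>
    { conn := connIn_closedNbhd G v r
      le := fun u _ => hG.degIn_le_card_freeColors σ (S r) u
      not_colorable := fun h => hno <| isRecoloring_of_listColorable hσ
        (fun y hy => closedNbhd_mono hr v ((hmem r y).1 hy))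
        ((hmem r v).2 (mem_closedNbhd_self G v r)) h }
  have hgrow : ∀ r ≤ R, (3 * Δ) ^ r ≤ (S r).card * (3 * Δ - 1) ^ r := by
    intro r
    induction r with
    | zero =>
      intro _
      have : 0 < (S 0).card := Finset.card_pos.2 ⟨v, (hmem 0 v).2 (mem_closedNbhd_self G v 0)⟩
      simpa using this
    | succ r ih =>
      intro hr
      have hb := hbad (r + 1) hr
      have h1 := hb.three_mul_sum_degIn_le hΔ hG.cliqueFree hG.degIn_le
      have hsub : S r ⊆ S (r + 1) := fun y hy =>
        (hmem _ y).2 (closedNbhd_mono (Nat.le_succ r) v ((hmem _ y).1 hy))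
      -- Vertices of the smaller ball have no neighbors outside the larger one, so all `Δ` colors
      -- are free for them, and badness makes this their degree.
      have h2 : (S r).card * Δ ≤ ∑ u ∈ S (r + 1), degIn G (S (r + 1)) u := by
        refine le_trans ?_ (Finset.sum_le_sum_of_subset hsub)
        rw [← smul_eq_mul, ← Finset.sum_const]
        refine Finset.sum_le_sum fun u hu => ?_
        rw [← hb.card_eq (hsub hu)]
        have : freeColors G σ (S (r + 1)) u = Finset.univ := by
          refine Finset.filter_true_of_mem fun c _ w hw huw => absurd ?_ hw
          exact (hmem _ w).2 (mem_closedNbhd_succ_of_adj ((hmem _ u).1 hu) huw)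
        rw [this, Finset.card_univ, Fintype.card_fin]
      have h3 : (S r).card * (3 * Δ) ≤ (S (r + 1)).card * (3 * Δ - 1) := by
        have h4 : 3 * Δ * (S (r + 1)).card = (S (r + 1)).card * (3 * Δ - 1) + (S (r + 1)).card := by
          rw [← Nat.mul_succ, Nat.succ_eq_add_one, Nat.sub_add_cancel (by omega), mul_comm]
        linarith
      calc (3 * Δ) ^ (r + 1) ≤ ((S r).card * (3 * Δ - 1) ^ r) * (3 * Δ) := by
            rw [pow_succ]
            exact Nat.mul_le_mul_right _ (ih (by omega))
        _ = ((S r).card * (3 * Δ)) * (3 * Δ - 1) ^ r := by ring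
        _ ≤ ((S (r + 1)).card * (3 * Δ - 1)) * (3 * Δ - 1) ^ r := Nat.mul_le_mul_right _ h3
        _ = (S (r + 1)).card * (3 * Δ - 1) ^ (r + 1) := by ring
  have hcard : (S R).card < f R := by
    have := hG.growth v R
    rw [← Set.Finite.coe_toFinset (Set.toFinite (closedNbhd G v R)),
      Set.encard_coe_eq_coe_finsetCard] at this
    exact_mod_cast this
  have hpos : 0 < (3 * Δ - 1) ^ R := pow_pos (by omega) _
  have := (hgrow R le_rfl).trans_lt (Nat.mul_lt_mul_of_pos_right hcard hpos)
  omega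

/-- With `ε = 1 / (3Δ - 1)`, `1 + ε` is the growth factor `3Δ / (3Δ - 1)`. -/
theorem Subexponential.exists_radius (hf : Subexponential f) (hΔ : 3 ≤ Δ) :
    ∃ R, f R * (3 * Δ - 1) ^ R ≤ (3 * Δ) ^ R := by
  have hm : (0 : ℝ) < ((3 * Δ - 1 : ℕ) : ℝ) := by exact_mod_cast (by omega : 0 < 3 * Δ - 1)
  have h := (hf (1 / ((3 * Δ - 1 : ℕ) : ℝ)) (by positivity)).bound (c := 1) one_pos
  obtain ⟨R, hR⟩ := h.exists
  refine ⟨R, ?_⟩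
  have h1 : (1 + 1 / ((3 * Δ - 1 : ℕ) : ℝ)) * ((3 * Δ - 1 : ℕ) : ℝ) = ((3 * Δ : ℕ) : ℝ) := by
    have : ((3 * Δ : ℕ) : ℝ) = ((3 * Δ - 1 : ℕ) : ℝ) + 1 := by
      exact_mod_cast (by omega : 3 * Δ = 3 * Δ - 1 + 1)
    rw [this]
    field_simp
  have hpos : (0 : ℝ) < 1 + 1 / ((3 * Δ - 1 : ℕ) : ℝ) := by positivity
  rw [one_mul, Real.norm_of_nonneg (by positivity), Real.norm_of_nonneg (by positivity)] at hR
  have h2 := mul_le_mul_of_nonneg_right hR (pow_pos hm R).le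
  rw [← mul_pow, h1] at h2
  exact_mod_cast h2

end LocalBrooks

/-! ### Local rules -/

section Locality

variable {L κ κ' : Type*} {H H' : SimpleGraph L} {s t : ℕ} {x y : L}

/-- `H` and `H'` have the same edges at the vertices of the ball of radius `t` around `x`. -/
def AgreeNear (t : ℕ) (x : L) (H H' : SimpleGraph L) : Prop :=
  ∀ y ∈ closedNbhd H x t, ∀ z, H.Adj y z ↔ H'.Adj y z

theorem AgreeNear.mono (h : AgreeNear t x H H') (hst : s ≤ t) : AgreeNear s x H H' :=
  fun y hy => h y (closedNbhd_mono hst x hy)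

theorem AgreeNear.of_mem (h : AgreeNear (s + t) x H H') (hy : y ∈ closedNbhd H x s) :
    AgreeNear t y H H' :=
  fun z hz => h z (mem_closedNbhd_add hy hz)

/-- Edges at the ball of radius `t` already determine the ball of radius `t + 1`. -/
theorem AgreeNear.closedNbhd_eq (h : AgreeNear t x H H') (hs : s ≤ t + 1) :
    closedNbhd H x s = closedNbhd H' x s := by
  ext w
  constructor
  · intro hw
    refine closedNbhd_induction (p := fun s w => s ≤ t + 1 → w ∈ closedNbhd H' x s)
      (fun r _ => mem_closedNbhd_self H' x r) (fun r a b ha ih hab hr => ?_) hw hs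
    exact mem_closedNbhd_succ_of_adj (ih (by omega))
      ((h a (closedNbhd_mono (by omega) x ha) b).1 hab)
  · intro hw
    refine closedNbhd_induction (p := fun s w => s ≤ t + 1 → w ∈ closedNbhd H x s)
      (fun r _ => mem_closedNbhd_self H x r) (fun r a b ha ih hab hr => ?_) hw hs
    have ha' := ih (by omega)
    exact mem_closedNbhd_succ_of_adj ha' ((h a (closedNbhd_mono (by omega) x ha') b).2 hab)

/-- The value of `Φ` at a vertex depends only on the ball of radius `t` around it. -/
def IsLocal (t : ℕ) (Φ : SimpleGraph L → L → κ) : Prop :=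
  ∀ H H' x, AgreeNear t x H H' → Φ H x = Φ H' x

/-- The new state of a vertex depends only on the ball of radius `s` around it and on the states of
the vertices of this ball. -/
def IsLocalStep (s : ℕ) (F : SimpleGraph L → (L → κ) → L → κ') : Prop :=
  ∀ H H' σ σ' x, AgreeNear s x H H' → (∀ y ∈ closedNbhd H x s, σ y = σ' y) →
    F H σ x = F H' σ' x

theorem IsLocalStep.comp {F : SimpleGraph L → (L → κ) → L → κ'} {Φ : SimpleGraph L → L → κ}
    (hF : IsLocalStep s F) (hΦ : IsLocal t Φ) : IsLocal (s + t) fun H => F H (Φ H) :=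
  fun H H' x h => hF H H' _ _ x (h.mono (Nat.le_add_right s t))
    fun y hy => hΦ H H' y (h.of_mem hy)

end Locality

/-! ### Color reduction -/

section ColorReduction

/-- A set is listed and padded to a tuple of length `D` over `Option α`. -/
theorem exists_encode_set (α : Type*) [Fintype α] (D : ℕ) :
    ∃ enc : Set α → ℕ, (∀ T, T.encard ≤ (D : ℕ∞) → enc T < (Fintype.card α + 1) ^ D) ∧
      ∀ T T', T.encard ≤ (D : ℕ∞) → T'.encard ≤ (D : ℕ∞) → enc T = enc T' → T = T' := by
  classical
  let e := Fintype.equivFin (Fin D → Option α)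
  have hcard : Fintype.card (Fin D → Option α) = (Fintype.card α + 1) ^ D := by simp
  let g : Set α → Fin D → Option α := fun T i => (Finset.univ.filter (· ∈ T)).toList[i.1]?
  have hg : ∀ T : Set α, T.encard ≤ D → ∀ a, a ∈ T ↔ ∃ i, g T i = some a := by
    intro T hT a
    have hlen : (Finset.univ.filter (· ∈ T)).toList.length ≤ D := by
      rw [Finset.length_toList]
      have : ((Finset.univ.filter (· ∈ T) : Finset α) : Set α) = T := by ext; simp
      rw [← this, Set.encard_coe_eq_coe_finsetCard] at hT
      exact_mod_cast hT
    have h1 : a ∈ T ↔ a ∈ (Finset.univ.filter (· ∈ T)).toList := by simp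
    rw [h1, List.mem_iff_getElem?]
    constructor
    · rintro ⟨i, hi⟩
      obtain ⟨hi', -⟩ := List.getElem?_eq_some_iff.1 hi
      exact ⟨⟨i, hi'.trans_le hlen⟩, hi⟩
    · rintro ⟨i, hi⟩
      exact ⟨i.1, hi⟩
  refine ⟨fun T => e (g T), fun T _ => ?_, fun T T' hT hT' h => ?_⟩
  · exact hcard ▸ (e (g T)).2
  · have : g T = g T' := e.injective (Fin.ext h)
    ext a
    rw [hg T hT, hg T' hT', this]

/-- The first binary digit in which `a` and `b` differ. -/
def firstDiff (a b : ℕ) : ℕ := sInf {i | a.testBit i ≠ b.testBit i}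

theorem testBit_firstDiff {a b : ℕ} (h : a ≠ b) :
    a.testBit (firstDiff a b) ≠ b.testBit (firstDiff a b) := by
  have hne : {i | a.testBit i ≠ b.testBit i}.Nonempty := by
    by_contra hc
    rw [Set.not_nonempty_iff_eq_empty, Set.eq_empty_iff_forall_notMem] at hc
    exact h (Nat.eq_of_testBit_eq fun i => by simpa using hc i)
  exact Nat.sInf_mem hne

theorem firstDiff_lt {a b ℓ : ℕ} (h : a ≠ b) (ha : a < 2 ^ ℓ) (hb : b < 2 ^ ℓ) :
    firstDiff a b < ℓ := by
  by_contra! hc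
  have hpow : 2 ^ ℓ ≤ 2 ^ firstDiff a b := Nat.pow_le_pow_right two_pos hc
  apply testBit_firstDiff h
  rw [Nat.testBit_lt_two_pow (ha.trans_le hpow), Nat.testBit_lt_two_pow (hb.trans_le hpow)]

variable {L : Type} {Δ : ℕ} {f : ℕ → ℕ} {k t ℓ : ℕ}

/-- The digits of the color of `x` at the places where it first differs from another color in the
ball of radius `k` around `x`. -/
def diffCode (ℓ k : ℕ) (H : SimpleGraph L) (σ : L → ℕ) (x : L) : Set (Fin ℓ × Bool) :=
  {p | ∃ y ∈ closedNbhd H x k, σ x ≠ σ y ∧ p.1.1 = firstDiff (σ x) (σ y) ∧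
    p.2 = (σ x).testBit p.1.1}

theorem isLocalStep_diffCode : IsLocalStep k (diffCode (L := L) ℓ k) := by
  intro H H' σ σ' x hH hσ
  have hx := hσ x (mem_closedNbhd_self H x k)
  ext p
  simp only [diffCode, Set.mem_ofPred_eq, ← hH.closedNbhd_eq (Nat.le_succ k), hx]
  exact exists_congr fun y => and_congr_right fun hy => by rw [hσ y hy]

theorem encard_diffCode_le (H : SimpleGraph L) (σ : L → ℕ) (x : L) :
    (diffCode ℓ k H σ x).encard ≤ (closedNbhd H x k).encard := by
  have hinj : Function.Injective fun p : Fin ℓ × Bool => (p.1.1, p.2) := by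
    rintro ⟨a, b⟩ ⟨c, d⟩ h
    simp only [Prod.mk.injEq] at h
    exact Prod.ext (Fin.ext h.1) h.2
  rw [← hinj.encard_image]
  refine le_trans (Set.encard_le_encard ?_) (Set.encard_image_le
    (fun y => (firstDiff (σ x) (σ y), (σ x).testBit (firstDiff (σ x) (σ y)))) _)
  rintro _ ⟨p, ⟨y, hy, -, h1, h2⟩, rfl⟩
  exact ⟨y, hy, by simp only [h2, h1]⟩

/-- All pairs in the code of `y` record digits of `σ y`, so the pair by which `x` differs from `y`
is not among them. -/
theorem diffCode_ne {H : SimpleGraph L} {σ : L → ℕ} (hσ : ∀ x, σ x < 2 ^ ℓ) {x y : L}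
    (hxy : y ∈ closedNbhd H x k) (hne : σ x ≠ σ y) :
    diffCode ℓ k H σ x ≠ diffCode ℓ k H σ y := by
  intro h
  have hx : ((⟨firstDiff (σ x) (σ y), firstDiff_lt hne (hσ x) (hσ y)⟩,
      (σ x).testBit (firstDiff (σ x) (σ y))) : Fin ℓ × Bool) ∈ diffCode ℓ k H σ x :=
    ⟨y, hxy, hne, rfl, rfl⟩
  rw [h] at hx
  obtain ⟨z, -, -, -, hz⟩ := hx
  exact testBit_firstDiff hne hz

/-- There is a local rule of radius `t` for coloring with `m` colors such that vertices at distance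
at most `k` get distinct colors. -/
def HasLocalDistColoring (L : Type) (Δ : ℕ) (f : ℕ → ℕ) (k t m : ℕ) : Prop :=
  ∃ Φ : SimpleGraph L → L → ℕ, IsLocal t Φ ∧ ∀ H, IsBrooksGraph Δ f H →
    (∀ x, Φ H x < m) ∧ ∀ x y, y ∈ closedNbhd H x k → x ≠ y → Φ H x ≠ Φ H y

/-- A code consists of at most `f k` of the `2 * ℓ` possible pairs, hence the logarithmic number of
digits. -/
theorem HasLocalDistColoring.reduce (h : HasLocalDistColoring L Δ f k t (2 ^ ℓ)) :
    HasLocalDistColoring L Δ f k (k + t) (2 ^ (f k * Nat.clog 2 (2 * ℓ + 1))) := by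
  obtain ⟨Φ, hloc, hΦ⟩ := h
  obtain ⟨enc, henc, hinj⟩ := exists_encode_set (Fin ℓ × Bool) (f k)
  refine ⟨fun H x => enc (diffCode ℓ k H (Φ H) x), fun H H' x hH => ?_, fun H hH => ?_⟩
  · exact congrArg enc (isLocalStep_diffCode.comp hloc H H' x hH)
  · have hcard : ∀ x, (diffCode ℓ k H (Φ H) x).encard ≤ f k := fun x =>
      (encard_diffCode_le H _ x).trans (hH.growth x k).le
    refine ⟨fun x => (henc _ (hcard x)).trans_le ?_, fun x y hxy hne hc => ?_⟩
    · have h1 : Fintype.card (Fin ℓ × Bool) + 1 = 2 * ℓ + 1 := by simp [mul_comm]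
      rw [h1, mul_comm (f k), pow_mul]
      exact Nat.pow_le_pow_left (Nat.le_pow_clog one_lt_two _) _
    · exact diffCode_ne (hΦ H hH).1 hxy ((hΦ H hH).2 x y hxy hne)
        (hinj _ _ (hcard x) (hcard y) hc)

theorem HasLocalDistColoring.iterate (h : HasLocalDistColoring L Δ f k t (2 ^ ℓ)) (j : ℕ) :
    HasLocalDistColoring L Δ f k (k * j + t)
      (2 ^ ((fun ℓ => f k * Nat.clog 2 (2 * ℓ + 1))^[j] ℓ)) := by
  induction j with
  | zero => simpa using h
  | succ j ih =>
    rw [Function.iterate_succ_apply']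
    have := ih.reduce
    rwa [← add_assoc, ← Nat.add_comm (k * j) k, ← Nat.mul_succ] at this

end ColorReduction

/-! ### Iterated logarithms -/

section LogStar

theorem clog_two_mul_add_one_le {m ℓ : ℕ} {y : ℝ} (hy : 2 < y) (h : (ℓ : ℝ) ≤ 2 ^ m * y) :
    (Nat.clog 2 (2 * ℓ + 1) : ℝ) ≤ (m + 4) * Real.logb 2 y := by
  have hpow : (1 : ℝ) ≤ 2 ^ m := one_le_pow₀ one_le_two
  have hlog : 1 ≤ Real.logb 2 y := by
    rw [Real.le_logb_iff_rpow_le one_lt_two (by linarith), Real.rpow_one]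
    exact hy.le
  have h1 : (Nat.clog 2 (2 * ℓ + 1) : ℝ) ≤ Real.logb 2 ((2 * ℓ + 1 : ℕ) : ℝ) + 1 := by
    have h2 := Real.natCeil_logb_natCast 2 (2 * ℓ + 1)
    rw [← h2]
    refine (Nat.ceil_lt_add_one (Real.logb_nonneg one_lt_two ?_)).le
    push_cast
    have : (0 : ℝ) ≤ ℓ := Nat.cast_nonneg ℓ
    linarith
  have h3 : Real.logb 2 ((2 * ℓ + 1 : ℕ) : ℝ) ≤ Real.logb 2 (2 ^ (m + 2) * y) := by
    refine Real.logb_le_logb_of_le one_lt_two (by positivity) ?_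
    push_cast
    rw [pow_add]
    nlinarith
  have h4 : Real.logb 2 (2 ^ (m + 2) * y) = m + 2 + Real.logb 2 y := by
    rw [Real.logb_mul (by positivity) (by linarith), Real.logb_pow,
      Real.logb_self_eq_one one_lt_two]
    push_cast
    ring
  have hm : (0 : ℝ) ≤ m := Nat.cast_nonneg m
  nlinarith

theorem two_mul_sq_le_two_pow {m : ℕ} (hm : 7 ≤ m) : 2 * m ^ 2 ≤ 2 ^ m := by
  induction m, hm using Nat.le_induction with
  | base => norm_num
  | succ m hm ih =>
    rw [pow_succ 2]
    nlinarith

/-- After `logStar n` steps, the number of binary digits of the colors is bounded. -/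
theorem exists_iterate_clog_le (c D : ℕ) : ∃ K : ℕ, ∀ n : ℕ,
    (fun ℓ => D * Nat.clog 2 (2 * ℓ + 1))^[logStar n] (c * n) ≤ K := by
  -- The invariant is that the number of digits after `j` rounds is at most `2 ^ m` times the `j`-th
  -- iterated logarithm of `n`. It holds at the start as `c ≤ 2 ^ m`, and persists as `D * (m + 4) ≤
  -- 2 * m ^ 2 ≤ 2 ^ m`.
  obtain ⟨m, hm7, hmD, hmc⟩ : ∃ m, 7 ≤ m ∧ D ≤ m ∧ c ≤ m :=
    ⟨7 + D + c, by omega, by omega, by omega⟩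
  have hstep : D * (m + 4) ≤ 2 ^ m :=
    le_trans (by nlinarith [Nat.mul_le_mul hmD (le_refl (m + 4))]) (two_mul_sq_le_two_pow hm7)
  refine ⟨2 ^ m * 2, fun n => ?_⟩
  have key : ∀ j ≤ logStar n,
      (((fun ℓ => D * Nat.clog 2 (2 * ℓ + 1))^[j] (c * n) : ℕ) : ℝ) ≤
        2 ^ m * (Real.logb 2)^[j] (n : ℝ) := by
    intro j
    induction j with
    | zero =>
      intro _
      have : c ≤ 2 ^ m := hmc.trans Nat.lt_two_pow_self.le
      have : (c : ℝ) ≤ 2 ^ m := by exact_mod_cast this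
      simpa using mul_le_mul_of_nonneg_right this (Nat.cast_nonneg n)
    | succ j ih =>
      intro hj
      -- Before round `logStar n` the iterated logarithm exceeds `2`, so its logarithm is at least
      -- `1` and absorbs additive constants.
      have hy : 2 < (Real.logb 2)^[j] (n : ℝ) := by
        by_contra! hc
        exact Nat.notMem_of_lt_sInf (show j < logStar n by omega) hc
      rw [Function.iterate_succ_apply', Function.iterate_succ_apply']
      have h1 := clog_two_mul_add_one_le hy (ih (by omega))
      have hlog : 0 ≤ Real.logb 2 ((Real.logb 2)^[j] (n : ℝ)) :=
        Real.logb_nonneg one_lt_two (by linarith)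
      have hstep' : (D : ℝ) * (m + 4) ≤ 2 ^ m := by exact_mod_cast hstep
      push_cast
      calc (D : ℝ) * _ ≤ D * ((m + 4) * Real.logb 2 ((Real.logb 2)^[j] (n : ℝ))) :=
            mul_le_mul_of_nonneg_left h1 (Nat.cast_nonneg D)
        _ = (D * (m + 4)) * Real.logb 2 ((Real.logb 2)^[j] (n : ℝ)) := by ring
        _ ≤ _ := mul_le_mul_of_nonneg_right hstep' hlog
  have hmem : (Real.logb 2)^[logStar n] (n : ℝ) ≤ 2 := Nat.sInf_mem (exists_iterate_logb_le_two n)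
  have h1 := (key _ le_rfl).trans (mul_le_mul_of_nonneg_left hmem (by positivity))
  exact_mod_cast h1

theorem one_le_logStar {n : ℕ} (hn : 3 ≤ n) : 1 ≤ logStar n := by
  by_contra! h
  have h0 : logStar n = 0 := by omega
  have hmem : (Real.logb 2)^[logStar n] (n : ℝ) ≤ 2 := Nat.sInf_mem (exists_iterate_logb_le_two n)
  rw [h0, Function.iterate_zero, id] at hmem
  have : (3 : ℝ) ≤ n := by exact_mod_cast hn
  linarith

end LogStar

/-! ### Extending the coloring one class at a time -/

section Stages

variable {L κ : Type} {Δ : ℕ} {f : ℕ → ℕ} {H H' : SimpleGraph L} {R i t m : ℕ}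

theorem AgreeNear.symm {x : L} (h : AgreeNear t x H H') : AgreeNear t x H' H := by
  intro y hy z
  rw [← h.closedNbhd_eq (Nat.le_succ t)] at hy
  exact (h y hy z).symm

theorem IsRecoloring.congr {σ σ' τ : L → Option κ} {v : L} (hH : AgreeNear R v H H')
    (hσ : ∀ y ∈ closedNbhd H v (R + 1), σ y = σ' y) (h : IsRecoloring H R σ v τ) :
    IsRecoloring H' R σ' v τ := by
  have hB := hH.closedNbhd_eq (Nat.le_succ R)
  refine ⟨fun y hy hy' => ?_, h.center, fun y hy z hz hyz => ?_, fun y hy z hz hyz => ?_⟩ <;>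
    rw [← hB] at hy
  · exact h.ne_none y hy (by rwa [hσ y (closedNbhd_mono (Nat.le_succ R) v hy)])
  · rw [← hB] at hz
    exact h.inside y hy z hz ((hH y hy z).2 hyz)
  · rw [← hB] at hz
    have hyz' := (hH y hy z).2 hyz
    rw [← hσ z (mem_closedNbhd_succ_of_adj hy hyz')]
    exact h.boundary y hy z hz hyz'

open Classical in
/-- Every vertex of class `i` recolors the ball of radius `R` around it so as to get colored. The
state of a vertex consists of its class and its color. -/
def stage (R i : ℕ) (H : SimpleGraph L) (st : L → ℕ × Option κ) (x : L) : ℕ × Option κ :=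
  if ∃ v, v ∈ closedNbhd H x R ∧ (st v).1 = i then
    ((st x).1, Classical.epsilon (IsRecoloring H R (fun y => (st y).2)
      (@Classical.epsilon L ⟨x⟩ fun v => v ∈ closedNbhd H x R ∧ (st v).1 = i)) x)
  else st x

/-- The chosen center is within `R` of `x`, and the recolorings around it depend only on states
within `R + 1` of it, the extra `1` being due to the boundary condition. -/
theorem isLocalStep_stage : IsLocalStep (2 * R + 1) (stage (L := L) (κ := κ) R i) := by
  intro H H' st st' x hH hst
  have : Nonempty L := ⟨x⟩
  have hx := hst x (mem_closedNbhd_self H x _)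
  have hP : (fun v => v ∈ closedNbhd H x R ∧ (st v).1 = i) =
      fun v => v ∈ closedNbhd H' x R ∧ (st' v).1 = i := by
    funext v
    rw [← hH.closedNbhd_eq (s := R) (by omega)]
    refine propext (and_congr_right fun hv => ?_)
    rw [hst v (closedNbhd_mono (by omega) x hv)]
  unfold stage
  rw [← hP, hx]
  split_ifs with hex
  · have hv : _ ∧ _ := Classical.epsilon_spec hex
    have hnear : AgreeNear R (Classical.epsilon fun v => v ∈ closedNbhd H x R ∧ (st v).1 = i)
        H H' := (hH.mono (s := R + R) (by omega)).of_mem hv.1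
    have hσ : ∀ y ∈ closedNbhd H
        (Classical.epsilon fun v => v ∈ closedNbhd H x R ∧ (st v).1 = i) (R + 1),
        (st y).2 = (st' y).2 := fun y hy => by
      rw [hst y (closedNbhd_mono (by omega) x (mem_closedNbhd_add hv.1 hy))]
    -- `Classical.epsilon` makes the same choice for equivalent predicates, so the choice is
    -- determined by local data.
    have : ∀ P Q : (L → Option κ) → Prop, (∀ τ, P τ ↔ Q τ) →
        (Classical.epsilon P) x = (Classical.epsilon Q) x := fun P Q hPQ => by
      rw [funext fun τ => propext (hPQ τ)]
    refine Prod.ext rfl (this _ _ fun τ => ⟨fun h => h.congr hnear hσ, fun h => ?_⟩)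
    refine h.congr hnear.symm fun y hy => (hσ y ?_).symm
    rwa [hnear.closedNbhd_eq le_rfl]
  · rfl

theorem stage_fst (st : L → ℕ × Option κ) (x : L) : (stage R i H st x).1 = (st x).1 := by
  unfold stage
  split_ifs <;> rfl

/-- The classes of the states are a coloring in which vertices at distance at most `2 * R + 1` get
distinct colors. -/
def IsSeparated (R : ℕ) (H : SimpleGraph L) (st : L → ℕ × Option κ) : Prop :=
  ∀ x y, y ∈ closedNbhd H x (2 * R + 1) → x ≠ y → (st x).1 ≠ (st y).1

/-- Two centers within `R` of `x` are at distance at most `2 * R`, so separation makes the center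
unique and the whole ball adopts one recoloring. -/
theorem stage_snd_of_mem {st : L → ℕ × Option κ} (hsep : IsSeparated R H st) {v x : L}
    (hv : (st v).1 = i) (hx : x ∈ closedNbhd H v R) :
    (stage R i H st x).2 =
      Classical.epsilon (IsRecoloring H R (fun y => (st y).2) v) x := by
  have hex : ∃ v, v ∈ closedNbhd H x R ∧ (st v).1 = i := ⟨v, mem_closedNbhd_comm.1 hx, hv⟩
  have : Nonempty L := ⟨x⟩
  have hspec := Classical.epsilon_spec hex
  have huniq : (Classical.epsilon fun v => v ∈ closedNbhd H x R ∧ (st v).1 = i) = v := by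
    by_contra hne
    refine hsep v _ ?_ (Ne.symm hne) (hv.trans hspec.2.symm)
    exact closedNbhd_mono (by omega) v (mem_closedNbhd_add hx hspec.1)
  unfold stage
  rw [if_pos hex, huniq]

theorem stage_snd_of_not_exists {st : L → ℕ × Option κ} {x : L}
    (h : ∀ v, (st v).1 = i → x ∉ closedNbhd H v R) : stage R i H st x = st x := by
  unfold stage
  rw [if_neg]
  rintro ⟨v, hv, hvi⟩
  exact h v hvi (mem_closedNbhd_comm.1 hv)

section Correct

variable [Finite L] {st : L → ℕ × Option (Fin Δ)}

theorem isRecoloring_epsilon (hH : IsBrooksGraph Δ f H) (hΔ : 3 ≤ Δ)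
    (hR : f R * (3 * Δ - 1) ^ R ≤ (3 * Δ) ^ R) (hσ : IsPartialColoring H fun y => (st y).2)
    (v : L) : IsRecoloring H R (fun y => (st y).2) v
      (Classical.epsilon (IsRecoloring H R (fun y => (st y).2) v)) :=
  Classical.epsilon_spec (hH.exists_isRecoloring hΔ hR hσ v)

theorem stage_ne_none (hH : IsBrooksGraph Δ f H) (hΔ : 3 ≤ Δ)
    (hR : f R * (3 * Δ - 1) ^ R ≤ (3 * Δ) ^ R) (hσ : IsPartialColoring H fun y => (st y).2)
    (hsep : IsSeparated R H st) {x : L} (hx : (st x).1 = i ∨ (st x).2 ≠ none) :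
    (stage R i H st x).2 ≠ none := by
  by_cases h : ∃ v, (st v).1 = i ∧ x ∈ closedNbhd H v R
  · obtain ⟨v, hv, hxv⟩ := h
    rcases hx with hx | hx
    · rw [stage_snd_of_mem hsep hx (mem_closedNbhd_self H x R)]
      exact (isRecoloring_epsilon hH hΔ hR hσ x).center
    · rw [stage_snd_of_mem hsep hv hxv]
      exact (isRecoloring_epsilon hH hΔ hR hσ v).ne_none x hxv hx
  · push Not at h
    rw [stage_snd_of_not_exists h]
    exact hx.resolve_left fun hxi => h x hxi (mem_closedNbhd_self H x R)

theorem stage_isPartialColoring (hH : IsBrooksGraph Δ f H) (hΔ : 3 ≤ Δ)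
    (hR : f R * (3 * Δ - 1) ^ R ≤ (3 * Δ) ^ R) (hσ : IsPartialColoring H fun y => (st y).2)
    (hsep : IsSeparated R H st) : IsPartialColoring H fun y => (stage R i H st y).2 := by
  have key : ∀ x y v, H.Adj x y → (st v).1 = i → x ∈ closedNbhd H v R →
      (stage R i H st x).2 ≠ none → (stage R i H st x).2 ≠ (stage R i H st y).2 := by
    intro x y v hxy hv hx hne
    have hrec := isRecoloring_epsilon hH hΔ hR hσ v
    rw [stage_snd_of_mem hsep hv hx] at hne ⊢
    by_cases hy : y ∈ closedNbhd H v R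
    · rw [stage_snd_of_mem hsep hv hy]
      exact hrec.inside x hx y hy hxy hne
    -- A second recolored ball containing `y` would have its center within `R + 1 + R` of `v`; this
    -- is why separation reaches to `2 * R + 1`.
    · rw [stage_snd_of_not_exists fun v' hv' hy' => ?_]
      · exact hrec.boundary x hx y hy hxy hne
      · have hvv : v ≠ v' := by rintro rfl; exact hy hy'
        refine hsep v v' ?_ hvv (hv.trans hv'.symm)
        have := mem_closedNbhd_add (mem_closedNbhd_succ_of_adj hx hxy) (mem_closedNbhd_comm.1 hy')
        exact closedNbhd_mono (by omega) v this
  intro x y hxy hne heq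
  by_cases hx : ∃ v, (st v).1 = i ∧ x ∈ closedNbhd H v R
  · obtain ⟨v, hv, hxv⟩ := hx
    exact key x y v hxy hv hxv hne heq
  · by_cases hy : ∃ v, (st v).1 = i ∧ y ∈ closedNbhd H v R
    · obtain ⟨v, hv, hyv⟩ := hy
      exact key y x v hxy.symm hv hyv (fun h => hne (heq.trans h)) heq.symm
    · push Not at hx hy
      simp only [stage_snd_of_not_exists hx, stage_snd_of_not_exists hy] at hne heq
      exact hσ x y hxy hne heq

end Correct

/-- The states after the stages for the classes `0, …, m - 1`. -/
def stages (R : ℕ) (Φ : SimpleGraph L → L → ℕ) : ℕ → SimpleGraph L → L → ℕ × Option κ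
  | 0 => fun H x => (Φ H x, none)
  | m + 1 => fun H => stage R m H (stages R Φ m H)

theorem isLocal_stages {Φ : SimpleGraph L → L → ℕ} (hΦ : IsLocal t Φ) (m : ℕ) :
    IsLocal ((2 * R + 1) * m + t) (stages (κ := κ) R Φ m) := by
  induction m with
  | zero =>
    intro H H' x h
    exact Prod.ext (hΦ H H' x (h.mono (by omega))) rfl
  | succ m ih =>
    have := (isLocalStep_stage (R := R) (i := m)).comp ih
    rwa [← add_assoc, Nat.add_comm (2 * R + 1), ← Nat.mul_succ] at this

theorem stages_fst (Φ : SimpleGraph L → L → ℕ) (x : L) :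
    (stages (κ := κ) R Φ m H x).1 = Φ H x := by
  induction m with
  | zero => rfl
  | succ m ih => exact (stage_fst _ x).trans ih

theorem HasLocalDistColoring.exists_local_coloring [Finite L] (hΔ : 3 ≤ Δ)
    (hR : f R * (3 * Δ - 1) ^ R ≤ (3 * Δ) ^ R)
    (h : HasLocalDistColoring L Δ f (2 * R + 1) t m) :
    ∃ Ψ : SimpleGraph L → L → Fin Δ, IsLocal ((2 * R + 1) * m + t) Ψ ∧
      ∀ H, IsBrooksGraph Δ f H → ∀ x y, H.Adj x y → Ψ H x ≠ Ψ H y := by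
  obtain ⟨Φ, hloc, hΦ⟩ := h
  -- The default color is never used on Brooks graphs: all vertices are colored after `m` stages.
  refine ⟨fun H x => (stages R Φ m H x).2.getD ⟨0, by omega⟩, fun H H' x hH => ?_,
    fun H hH x y hxy heq => ?_⟩
  · simp only [isLocal_stages hloc m H H' x hH]
  · have hsep : ∀ j, IsSeparated R H (stages (κ := Fin Δ) R Φ j H) := by
      intro j x y hy hne
      rw [stages_fst, stages_fst]
      exact (hΦ H hH).2 x y hy hne
    have hcol : ∀ j, IsPartialColoring H fun y => (stages (κ := Fin Δ) R Φ j H y).2 := by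
      intro j
      induction j with
      | zero => exact fun x y _ hx => absurd rfl hx
      | succ j ih => exact stage_isPartialColoring hH hΔ hR ih (hsep j)
    have hdone : ∀ j z, Φ H z < j → (stages (κ := Fin Δ) R Φ j H z).2 ≠ none := by
      intro j z
      induction j with
      | zero => exact fun hz => absurd hz (Nat.not_lt_zero _)
      | succ j ih =>
        intro hz
        refine stage_ne_none hH hΔ hR (hcol j) (hsep j) ?_
        rw [stages_fst]
        rcases Nat.lt_succ_iff_lt_or_eq.1 hz with hz | hz
        · exact Or.inr (ih hz)
        · exact Or.inl hz
    have hx := hdone m x ((hΦ H hH).1 x)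
    have hy := hdone m y ((hΦ H hH).1 y)
    have hne := hcol m x y hxy hx
    obtain ⟨a, ha⟩ := Option.ne_none_iff_exists'.1 hx
    obtain ⟨b, hb⟩ := Option.ne_none_iff_exists'.1 hy
    simp only [ha, hb, Option.getD_some, ne_eq, Option.some.injEq] at heq hne
    exact hne heq

end Stages

theorem HasLocalDistColoring.mono {L : Type} {Δ : ℕ} {f : ℕ → ℕ} {k t m m' : ℕ}
    (h : HasLocalDistColoring L Δ f k t m) (hm : m ≤ m') : HasLocalDistColoring L Δ f k t m' := by
  obtain ⟨Φ, hloc, hΦ⟩ := h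
  exact ⟨Φ, hloc, fun H hH => ⟨fun x => ((hΦ H hH).1 x).trans_le hm, (hΦ H hH).2⟩⟩

theorem hasLocalDistColoring_fin {Δ : ℕ} {f : ℕ → ℕ} {k N : ℕ} :
    HasLocalDistColoring (Fin N) Δ f k 0 N :=
  ⟨fun _ x => x, fun _ _ _ _ => rfl, fun _ _ => ⟨fun x => x.2, fun _ _ _ hne h => hne (Fin.ext h)⟩⟩

/-- Brooks coloring by local rules on the graphs whose vertices are the identifiers. -/
theorem exists_local_brooks_coloring {Δ : ℕ} (hΔ : 3 ≤ Δ) {f : ℕ → ℕ} (hf : Subexponential f)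
    (c : ℕ) : ∃ a b : ℕ, ∀ n : ℕ, ∃ Ψ : SimpleGraph (Fin (n ^ c)) → Fin (n ^ c) → Fin Δ,
      IsLocal (a * logStar n + b) Ψ ∧
        ∀ H, IsBrooksGraph Δ f H → ∀ x y, H.Adj x y → Ψ H x ≠ Ψ H y := by
  obtain ⟨R, hR⟩ := hf.exists_radius hΔ
  obtain ⟨K, hK⟩ := exists_iterate_clog_le c (f (2 * R + 1))
  refine ⟨2 * R + 1, (2 * R + 1) * 2 ^ K, fun n => ?_⟩
  -- The identifiers serve as initial colors, and the crude bound `n ≤ 2 ^ n` on their length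
  -- suffices.
  have h0 : HasLocalDistColoring (Fin (n ^ c)) Δ f (2 * R + 1) 0 (2 ^ (c * n)) := by
    refine hasLocalDistColoring_fin.mono ?_
    rw [mul_comm, pow_mul]
    exact Nat.pow_le_pow_left Nat.lt_two_pow_self.le c
  have h1 := (h0.iterate (logStar n)).mono (Nat.pow_le_pow_right two_pos (hK n))
  obtain ⟨Ψ, h2, h3⟩ := h1.exists_local_coloring hΔ hR
  exact ⟨Ψ, by rwa [add_zero, add_comm] at h2, h3⟩

/-! ### From graphs on identifiers to labeled graphs -/

section Transfer

variable {V : Type u} {L : Type} {G : SimpleGraph V} {ident : V ↪ L} {Δ : ℕ} {f : ℕ → ℕ}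

theorem exists_of_mem_closedNbhd_map {v : V} {r : ℕ} {w : L}
    (h : w ∈ closedNbhd (G.map ident) (ident v) r) : ∃ w' ∈ closedNbhd G v r, ident w' = w := by
  refine closedNbhd_induction (p := fun r w => ∃ w' ∈ closedNbhd G v r, ident w' = w)
    (fun r => ⟨v, mem_closedNbhd_self G v r, rfl⟩) ?_ h
  rintro r _ y - ⟨x, hx, rfl⟩ hxy
  obtain ⟨x', y', hxy', hx', rfl⟩ := (SimpleGraph.map_adj _ _ _ _).1 hxy
  rw [ident.injective hx'] at hxy'
  exact ⟨y', mem_closedNbhd_succ_of_adj hx hxy', rfl⟩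

/-- Edges at vertices within distance `t` end within distance `t + 1`, so the induced ball must have
radius `t + 1` to show them all. -/
theorem agreeNear_labeledBall (G : SimpleGraph V) (ident : V ↪ L) (v : V) (t : ℕ) :
    AgreeNear t (ident v) (G.map ident) (labeledBall G ident v (t + 1)).graph := by
  intro y hy z
  let e : closedNbhd G v (t + 1) ↪ L := (Function.Embedding.subtype _).trans ident
  have hmap : ∀ y z, (labeledBall G ident v (t + 1)).graph.Adj y z ↔ ∃ u' v',
      (G.induce (closedNbhd G v (t + 1))).Adj u' v' ∧ e u' = y ∧ e v' = z :=
    fun y z => SimpleGraph.map_adj e (G.induce (closedNbhd G v (t + 1))) y z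
  rw [hmap, SimpleGraph.map_adj]
  obtain ⟨y₀, hy₀, rfl⟩ := exists_of_mem_closedNbhd_map hy
  constructor
  · rintro ⟨y', z', hyz, hy', rfl⟩
    obtain rfl := ident.injective hy'
    exact ⟨⟨y', closedNbhd_mono (Nat.le_succ t) v hy₀⟩, ⟨z', mem_closedNbhd_succ_of_adj hy₀ hyz⟩,
      hyz, rfl, rfl⟩
  · rintro ⟨y', z', hyz, hy', hz'⟩
    exact ⟨y', z', hyz, hy', hz'⟩

theorem IsBrooksGraph.map [Nonempty V] (h : IsBrooksGraph Δ f G) (ident : V ↪ L) :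
    IsBrooksGraph Δ f (G.map ident) where
  degree_le := by
    intro x
    by_cases hx : ∃ v, ident v = x
    · obtain ⟨v, rfl⟩ := hx
      refine (Set.encard_le_encard ?_).trans ((Set.encard_image_le ident _).trans (h.degree_le v))
      intro y hy
      obtain ⟨v', y', hvy, hv', rfl⟩ := (SimpleGraph.map_adj _ _ _ _).1 hy
      obtain rfl := ident.injective hv'
      exact ⟨y', hvy, rfl⟩
    · have : (G.map ident).neighborSet x = ∅ := by
        refine Set.eq_empty_iff_forall_notMem.2 fun y hy => hx ?_
        obtain ⟨v', y', -, hv', -⟩ := (SimpleGraph.map_adj _ _ _ _).1 hy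
        exact ⟨v', hv'⟩
      simp [this]
  cliqueFree := SimpleGraph.cliqueFree_map_iff.2 h.cliqueFree
  growth := by
    intro x r
    by_cases hx : ∃ v, ident v = x
    · obtain ⟨v, rfl⟩ := hx
      refine lt_of_le_of_lt (Set.encard_le_encard ?_)
        ((Set.encard_image_le ident _).trans_lt (h.growth v r))
      exact fun y hy => exists_of_mem_closedNbhd_map hy
    -- Unused identifiers are isolated, so their balls have one vertex; `1 < f r` follows from a
    -- ball of `G`, which is where `V` has to be nonempty.
    · have h1 : closedNbhd (G.map ident) x r ⊆ {x} := by
        intro y hy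
        refine closedNbhd_induction (p := fun _ y => y = x) (fun _ => rfl) ?_ hy
        rintro _ _ z - rfl hxz
        obtain ⟨v', y', -, hv', -⟩ := (SimpleGraph.map_adj _ _ _ _).1 hxz
        exact absurd ⟨v', hv'⟩ hx
      obtain ⟨v⟩ := ‹Nonempty V›
      refine (Set.encard_le_encard h1).trans_lt (lt_of_le_of_lt ?_ (h.growth v r))
      rw [Set.encard_singleton, Set.one_le_encard_iff_nonempty]
      exact ⟨v, mem_closedNbhd_self G v r⟩

end Transfer

end

/-- Brooks coloring with `Δ` colors in `O(log* n)` rounds on classes of subexponential growth. -/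
theorem mainTheorem2 (Δ : ℕ) (hΔ : 3 ≤ Δ) (f : ℕ → ℕ) (hf : Subexponential f)
    (F : FinGraphClass.{u})
    (hgrowth : ∀ (V : Type u) [Finite V] (G : SimpleGraph V), F V G → BoundsGrowth f G)
    (hdeg : ∀ (V : Type u) [Finite V] (G : SimpleGraph V), F V G →
      ∀ v : V, (G.neighborSet v).encard ≤ (Δ : ℕ∞))
    (hclique : ∀ (V : Type u) [Finite V] (G : SimpleGraph V), F V G → G.CliqueFree (Δ + 1))
    (c : ℕ) (hc : 1 ≤ c) :
    ∃ t : ℕ → ℕ,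
      (fun n : ℕ => (t n : ℝ)) =O[atTop] (fun n : ℕ => (logStar n : ℝ)) ∧
        HasDetLocalColoring F c Δ t := by
  obtain ⟨a, b, h⟩ := exists_local_brooks_coloring hΔ hf c
  choose Ψ hloc hΨ using h
  refine ⟨fun n => a * logStar n + b + 1, ?_, fun n B => Ψ n B.graph B.root, ?_⟩
  · refine IsBigO.of_bound ((a + b + 1 : ℕ) : ℝ) ?_
    -- From `n = 3` on, `logStar n ≥ 1` absorbs the additive constant.
    filter_upwards [eventually_ge_atTop 3] with n hn
    rw [Real.norm_of_nonneg (Nat.cast_nonneg _), Real.norm_of_nonneg (Nat.cast_nonneg _)]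
    have := one_le_logStar hn
    have : a * logStar n + b + 1 ≤ (a + b + 1) * logStar n := by nlinarith
    exact_mod_cast this
  · intro V _ G hG ident v w hvw
    have hV : Nonempty V := ⟨v⟩
    have hB : IsBrooksGraph Δ f G := ⟨hdeg V G hG, hclique V G hG, hgrowth V G hG⟩
    have hout : ∀ x, DetDistributedAlgorithm.output (fun n B => Ψ n B.graph B.root)
        (fun n => a * logStar n + b + 1) G ident x =
          Ψ (Nat.card V) (G.map ident) (ident x) := fun x =>
      (hloc _ _ _ _ (agreeNear_labeledBall G ident x _)).symm
    rw [hout, hout]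
    exact hΨ _ _ (hB.map ident) _ _ ((SimpleGraph.map_adj _ _ _ _).2 ⟨v, w, hvw, rfl, rfl⟩)
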